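/- **Generalized quantum digital-to-analog conversion.** For an $m$-bit string $\mathbf b=b^{(1)}\cdots b^{(m)}$ write $b=\sum_{k=1}^m b^{(k)}2^{-k}\in[0,1)$. Let $f:[0,1)\to[0,1)$ be computable by quantum arithmetics in the following sense: there is a polynomial $q$ such that for every $m$ the transformation $|\mathbf a\rangle|0\rangle\mapsto|\mathbf a\rangle|\tilde{\mathbf g}(\mathbf a)\rangle$ of $m$-bit strings $\mathbf a$, with a bit string $\tilde{\mathbf g}(\mathbf a)$ representing a number $\tilde g(\mathbf a)\in[0,1)$ such that $|\tilde g(\mathbf a)-f(a)|\le 2^{-m}$, can be performed (with work qubits that start and end in $|0\rangle$) by at most $q(m)$ steps, each of which is a single- or two-qubit gate, an addition $|\mathbf a\rangle|\mathbf b\rangle\mapsto|\mathbf a\rangle|\mathbf a+\mathbf b\rangle$ or a multiplication $|\mathbf a\rangle|\mathbf b\rangle|\mathbf c\rangle\mapsto|\mathbf a\rangle|\mathbf b\rangle|\mathbf c+\mathbf a\mathbf b\rangle$ on registers of at most $q(m)$ qubits (integer arithmetic modulo the size of the target register). Then there is a polynomial $p$ such that for every $m$ and every accuracy $0<\epsilon\le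 2^{-m}$ (in particular $\epsilon=2^{-m}$) there is a function $\tilde f:\{0,1\}^m\to\mathbb R$ with $|\tilde f(\mathbf b)-f(b)|\le\epsilon$ for all $\mathbf b$, and for every $n$, with $N=2^n$, a quantum algorithm with the following properties. It acts on $n$ address qubits, $m$ data qubits and some number of ancilla qubits that start in $|0\rangle$; it uses at most $p(\log_2(1/\epsilon))$ single-qubit gates, two-qubit gates and single-qubit measurements, and exactly one call of $U_D^\dagger$, where $U_D$ is a given unitary on the address and data qubits; it is independent of the data and of $U_D$. Whenever $(\mathbf d_j)_{j\in\{0,1\}^n}$ are $m$-bit strings and $U_D|j\rangle|0\rangle=|j\rangle|\mathbf d_j\rangle$ for all $j$, the algorithm, run on the digital-encoded state $\frac1{\sqrt N}\sum_j|j\rangle|\mathbf d_j\rangle$, succeeds (that is, all its measurements have prescribed outcomes) with probability $P=\frac1N\sum_j\tilde f(\mathbf d_j)^2$, and if $P>0$, then its state after success is $$C'\sum_j\tilde f(\mathbf d_j)\,|j\rangle|0\rangle$$ with all ancillas in $|0\rangle$, for a constant $C'>0$ with $P=\frac{1}{N\,C'^2}$. -/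

import Mathlib

open scoped Polynomial

noncomputable section

namespace QDAC

/-! ### States of a qubit register -/

/-- A (not necessarily normalized) pure state of qubits labelled by `ι`, as its amplitudes in the
computational basis. -/
abbrev State (ι : Type) : Type := (ι → Bool) → ℂ

/-- The computational basis state `|x⟩`. -/
def ket {ι : Type} [DecidableEq ι] [Fintype ι] (x : ι → Bool) : State ι := Pi.single x 1

/-- The squared norm of a state. -/
def normSq {ι : Type} [DecidableEq ι] [Fintype ι] (ψ : State ι) : ℝ := ∑ x, ‖ψ x‖ ^ 2

/-- The normalization of a nonzero state. -/
def normalize {ι : Type} [DecidableEq ι] [Fintype ι] (ψ : State ι) : State ι :=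
  (((1 / √(normSq ψ) : ℝ)) : ℂ) • ψ

/-- The all-zero bit string. -/
def zeros (ι : Type) : ι → Bool := fun _ => false

/-- The number `∑_{k = 1}^m b^{(k)} 2^{-k}` in `[0, 1)` represented by the `m`-bit string
`b^{(1)} ⋯ b^{(m)}`; the bit `b^{(k)}` is `b i` with `k = i + 1`. -/
def fracVal {m : ℕ} (b : Fin m → Bool) : ℝ :=
  ∑ i : Fin m, if b i then (1 / 2 : ℝ) ^ ((i : ℕ) + 1) else 0

/-! ### Single- and two-qubit gates -/

/-- An arbitrary single-qubit gate on one qubit, or an arbitrary two-qubit gate on two distinct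
qubits. -/
inductive Gate (ι : Type) : Type
  | one (i : ι) (U : Matrix.unitaryGroup Bool ℂ) : Gate ι
  | two (i j : ι) (hij : i ≠ j) (U : Matrix.unitaryGroup (Bool × Bool) ℂ) : Gate ι

/-- The action of a gate on a state: the gate acts on its own qubits, tensored with the identity on
all others. -/
def Gate.apply {ι : Type} [DecidableEq ι] [Fintype ι] : Gate ι → State ι → State ι
  | .one i U, ψ => fun x =>
      ∑ b : Bool, (U : Matrix Bool Bool ℂ) (x i) b * ψ (Function.update x i b)
  | .two i j _ U, ψ => fun x =>
      ∑ b : Bool × Bool, (U : Matrix (Bool × Bool) (Bool × Bool) ℂ) (x i, x j) b *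
        ψ (Function.update (Function.update x i b.1) j b.2)

/-! ### Quantum arithmetics -/

/-- The natural number held, least significant bit first, by the register of qubits
`r 0, …, r (w - 1)` in the basis state `|x⟩`. -/
def regVal {ι : Type} {w : ℕ} (r : Fin w → ι) (x : ι → Bool) : ℕ :=
  ∑ i : Fin w, if x (r i) then 2 ^ (i : ℕ) else 0

/-- Overwrite the register `r` by the lowest `w` binary digits of `v`. -/
def writeReg {ι : Type} {w : ℕ} (r : Fin w → ι) (v : ℕ) (x : ι → Bool) : ι → Bool :=
  Function.extend r (fun i : Fin w => v.testBit (i : ℕ)) x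

/-- The linear extension of the map `|x⟩ ↦ |σ x⟩` of basis states. -/
def applyClassical {ι : Type} [DecidableEq ι] [Fintype ι]
    (σ : (ι → Bool) → (ι → Bool)) (ψ : State ι) : State ι :=
  fun y => ∑ x, if σ x = y then ψ x else 0

/-- One step of a quantum arithmetic computation: an elementary gate, an addition
`|a⟩|b⟩ ↦ |a⟩|a + b⟩` of two `w`-bit registers (modulo `2 ^ w`), or a multiplication
`|a⟩|b⟩|c⟩ ↦ |a⟩|b⟩|c + a b⟩` of two `w`-bit registers into a `v`-bit register (modulo `2 ^ v`),
which is `|a⟩|b⟩|0⟩ ↦ |a⟩|b⟩|a b⟩` on an empty target. The registers consist of distinct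
qubits. -/
inductive ArithOp (ι : Type) : Type
  | gate (g : Gate ι) : ArithOp ι
  | add (w : ℕ) (a b : Fin w → ι) (h : Function.Injective (Sum.elim a b)) : ArithOp ι
  | mul (w v : ℕ) (a b : Fin w → ι) (c : Fin v → ι)
      (h : Function.Injective (Sum.elim a (Sum.elim b c))) : ArithOp ι

/-- The action of an arithmetic step on a state. -/
def ArithOp.apply {ι : Type} [DecidableEq ι] [Fintype ι] : ArithOp ι → State ι → State ι
  | .gate g, ψ => g.apply ψ
  | .add _ a b _, ψ =>
      applyClassical (fun x => writeReg b (regVal a x + regVal b x) x) ψ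
  | .mul _ _ a b c _, ψ =>
      applyClassical (fun x => writeReg c (regVal c x + regVal a x * regVal b x) x) ψ

/-- The number of bits of the largest register on which an arithmetic step operates as on a
number. -/
def ArithOp.width {ι : Type} : ArithOp ι → ℕ
  | .gate _ => 0
  | .add w _ _ _ => w
  | .mul w v _ _ _ _ => max w v

/-- Execute a list of arithmetic steps, first element first. -/
def runArith {ι : Type} [DecidableEq ι] [Fintype ι] (P : List (ArithOp ι)) (ψ : State ι) :
    State ι :=
  P.foldl (fun φ op => op.apply φ) ψ

/-- Qubits in three registers. -/
abbrev Wire (p q s : ℕ) : Type := Fin p ⊕ (Fin q ⊕ Fin s)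

/-- The bit string made of the contents of the three registers. -/
def join {p q s : ℕ} (x : Fin p → Bool) (y : Fin q → Bool) (z : Fin s → Bool) :
    Wire p q s → Bool :=
  Sum.elim x (Sum.elim y z)

/-- `f` can be calculated by quantum arithmetics: for every `m`, to accuracy `ε = 2 ^ (-m)` on
numbers `a` given as `m`-bit strings, a transformation `|a⟩|0⟩ ↦ |a⟩|f̃(a)⟩` with
`|f̃(a) - f(a)| ≤ ε` can be performed by polynomially many (in `m = log₂ (1 / ε)`) arithmetic steps
on numbers of polynomially many bits. The result register has some number `r` of bits; `s` work
qubits start and end in `|0⟩`. -/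
def ArithComputable (f : ℝ → ℝ) : Prop :=
  ∃ p : ℕ[X], ∀ m : ℕ,
    ∃ (r s : ℕ) (P : List (ArithOp (Wire m r s))) (ft : (Fin m → Bool) → (Fin r → Bool)),
      P.length ≤ p.eval m ∧
      (∀ op ∈ P, op.width ≤ p.eval m) ∧
      (∀ a : Fin m → Bool,
        runArith P (ket (join a (zeros (Fin r)) (zeros (Fin s)))) =
          ket (join a (ft a) (zeros (Fin s)))) ∧
      (∀ a : Fin m → Bool, |fracVal (ft a) - f (fracVal a)| ≤ (1 / 2 : ℝ) ^ m)

/-! ### Digital encoding and quantum algorithms -/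

/-- A unitary operator on an `n`-qubit address register and an `m`-qubit data register. -/
abbrev OracleUnitary (n m : ℕ) : Type :=
  Matrix.unitaryGroup ((Fin n → Bool) × (Fin m → Bool)) ℂ

/-- `U` is a digital-encoding unitary of the data `d`: `U |j⟩|0⟩ = |j⟩|d_j⟩` for every address
`j`. Nothing is required of `U` on data registers not in the state `|0⟩`. -/
def IsDigitalEncoding {n m : ℕ} (d : (Fin n → Bool) → (Fin m → Bool)) (U : OracleUnitary n m) :
    Prop :=
  ∀ j : Fin n → Bool,
    Matrix.mulVec (U : Matrix _ _ ℂ) (Pi.single (j, zeros (Fin m)) 1) = Pi.single (j, d j) 1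

/-- One instruction of a quantum algorithm on `n` address qubits, `m` data qubits and `k` ancilla
qubits: an elementary gate, a call of the inverse of the given digital-encoding unitary on the
address and data registers, or a measurement of the qubit `i` in the computational basis, after
which the algorithm goes on if the outcome is `o` and otherwise stops with failure. -/
inductive Instr (n m k : ℕ) : Type
  | gate (g : Gate (Wire n m k)) : Instr n m k
  | oracleInv : Instr n m k
  | measure (i : Wire n m k) (o : Bool) : Instr n m k

/-- The action of an instruction on the unnormalized state of the branch in which all measurements
so far had the demanded outcomes. -/
def Instr.apply {n m k : ℕ} (U : OracleUnitary n m) :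
    Instr n m k → State (Wire n m k) → State (Wire n m k)
  | .gate g, ψ => g.apply ψ
  | .oracleInv, ψ => fun x =>
      ∑ y : (Fin n → Bool) × (Fin m → Bool),
        ((U⁻¹ : OracleUnitary n m) : Matrix _ _ ℂ)
          (fun i => x (Sum.inl i), fun i => x (Sum.inr (Sum.inl i))) y *
          ψ (join y.1 y.2 (fun i => x (Sum.inr (Sum.inr i))))
  | .measure i o, ψ => fun x => if x i = o then ψ x else 0

/-- A quantum algorithm is a list of instructions, executed first element first. It does not
depend on the data or on the digital-encoding unitary, which it only calls. -/
abbrev Algorithm (n m k : ℕ) : Type := List (Instr n m k)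

/-- The unnormalized final state of the successful branch. -/
def Algorithm.run {n m k : ℕ} (A : Algorithm n m k) (U : OracleUnitary n m)
    (ψ : State (Wire n m k)) : State (Wire n m k) :=
  List.foldl (fun φ c => c.apply U φ) ψ A

/-- The probability, by the Born rule, that all measurements have the demanded outcomes, for a
normalized input `ψ`. -/
def Algorithm.successProb {n m k : ℕ} (A : Algorithm n m k) (U : OracleUnitary n m)
    (ψ : State (Wire n m k)) : ℝ :=
  normSq (A.run U ψ)

/-- The state of all qubits after a successful execution. -/
def Algorithm.output {n m k : ℕ} (A : Algorithm n m k) (U : OracleUnitary n m)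
    (ψ : State (Wire n m k)) : State (Wire n m k) :=
  normalize (A.run U ψ)

/-- Whether an instruction is a call of the inverse digital-encoding unitary. -/
def Instr.isOracle {n m k : ℕ} : Instr n m k → Bool
  | .oracleInv => true
  | _ => false

/-- The number of calls of the inverse digital-encoding unitary. -/
def Algorithm.oracleCount {n m k : ℕ} (A : Algorithm n m k) : ℕ :=
  List.countP (fun c => c.isOracle) A

/-- The number of single-qubit gates, two-qubit gates and single-qubit measurements. -/
def Algorithm.elementaryCount {n m k : ℕ} (A : Algorithm n m k) : ℕ :=
  List.countP (fun c => !c.isOracle) A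

/-- The digital-encoded state `N^{-1/2} ∑_j |j⟩|d_j⟩`, `N = 2 ^ n`, with all ancillas in `|0⟩`. -/
def digitalState {n m : ℕ} (k : ℕ) (d : (Fin n → Bool) → (Fin m → Bool)) : State (Wire n m k) :=
  ((1 / √((2 : ℝ) ^ n) : ℝ) : ℂ) • ∑ j : Fin n → Bool, ket (join j (d j) (zeros (Fin k)))

end QDAC

end

/-! A demanded measurement outcome is a projection, so the unnormalized state of the successful
branch depends linearly on the input, and its squared norm is the success probability. It therefore
suffices to follow each basis state `|j⟩|d_j⟩|0⟩` separately and to show that it ends as `v_j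
|j⟩|0⟩|0⟩`, where the real number `v_j` approximates `f(d_j)` and depends on `d_j` alone.

The algorithm computes a digit string for `f(d_j)` reversibly into ancillas, turns this string into
an amplitude, and undoes the computation. The conversion multiplies a basis state by a scalar and
returns its scratch qubits to `|0⟩`, so the inverse circuit still erases the digits, and `U_D†` then
maps `|j⟩|d_j⟩` to `|j⟩|0⟩` (`exists_algorithm`).

The conversion (`runLin_dac`) uses no rotations that depend on the digits. Fresh qubits `y` are put
into uniform superposition. The first zero of `y` is at position `i` (counted from 0) with weight
`2^{-(i+1)}`, and such a branch survives exactly if digit `i` is set; the all-ones string is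
rejected. Hadamard gates followed by projection of `y` onto `|0⟩` average the survival indicators,
which gives the binary fraction as the amplitude. Recursively this is `fracVal_succ`, and the cost
is linear in the number of digits.

Arithmetic steps must become elementary gates. An addition is a sequence of controlled additions of
powers of two with carry ancillas, and a multiplication is schoolbook multiplication with Toffoli
gates (`circuit_addCircuit`, `circuit_mulCircuit`). Since arbitrary gates may occur between
arithmetic steps, intermediate states need not be basis states; the simulation is therefore an
identity of linear maps (`circuit_compile`).

The hypothesis does not bound the length of the result register polynomially. The result is cut to
at most as many digits as the working precision, and one extra bit of precision pays for the cut. -/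

noncomputable section

namespace QDAC

variable {ι κ : Type} [DecidableEq ι] [Fintype ι] [DecidableEq κ] [Fintype κ]

/-! ### Linearity and inverses of gates -/

/-- A gate as a linear map. -/
def Gate.toLin (g : Gate ι) : State ι →ₗ[ℂ] State ι where
  toFun := g.apply
  map_add' ψ φ := by
    cases g <;> funext x <;> simp [Gate.apply, mul_add, Finset.sum_add_distrib]
  map_smul' c ψ := by
    cases g <;> funext x <;> simp only [Gate.apply, Pi.smul_apply, smul_eq_mul, RingHom.id_apply,
      Finset.mul_sum] <;> exact Finset.sum_congr rfl fun b _ => by ring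

/-- The linear map of a list of gates, executed first element first. -/
def circuit : List (Gate ι) → State ι →ₗ[ℂ] State ι
  | [] => LinearMap.id
  | g :: G => circuit G ∘ₗ g.toLin

@[simp] theorem circuit_nil (ψ : State ι) : circuit [] ψ = ψ := rfl

theorem circuit_cons (g : Gate ι) (G : List (Gate ι)) (ψ : State ι) :
    circuit (g :: G) ψ = circuit G (g.apply ψ) := rfl

theorem circuit_append (G H : List (Gate ι)) (ψ : State ι) :
    circuit (G ++ H) ψ = circuit H (circuit G ψ) := by
  induction G generalizing ψ with
  | nil => rfl
  | cons g G ih => simp [circuit_cons, ih]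

/-- The inverse gate. -/
def Gate.inv : Gate ι → Gate ι
  | .one i U => .one i U⁻¹
  | .two i j h U => .two i j h U⁻¹

theorem Gate.inv_apply_apply (g : Gate ι) (ψ : State ι) : g.inv.apply (g.apply ψ) = ψ := by
  cases g with
  | one i U =>
    funext x
    have hU : (U⁻¹).1 * U.1 = 1 :=
      congrArg Subtype.val (inv_mul_cancel U)
    calc (Gate.one i U).inv.apply ((Gate.one i U).apply ψ) x
        = ∑ c, ((U⁻¹).1 * U.1) (x i) c * ψ (Function.update x i c) := by
          simp only [Gate.inv, Gate.apply, Matrix.mul_apply, Finset.mul_sum, Finset.sum_mul,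
            Function.update_self, Function.update_idem]
          rw [Finset.sum_comm]
          simp only [mul_assoc]
      _ = ψ x := by rw [hU]; simp [Matrix.one_apply]
  | two i j h U =>
    funext x
    have hU : (U⁻¹).1 * U.1 = 1 :=
      congrArg Subtype.val (inv_mul_cancel U)
    have hup : ∀ b c : Bool × Bool, Function.update (Function.update (Function.update
        (Function.update x i b.1) j b.2) i c.1) j c.2 =
        Function.update (Function.update x i c.1) j c.2 := by
      intro b c
      funext k
      simp only [Function.update_apply]
      split_ifs <;> rfl
    calc (Gate.two i j h U).inv.apply ((Gate.two i j h U).apply ψ) x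
        = ∑ c, ((U⁻¹).1 * U.1) (x i, x j) c *
            ψ (Function.update (Function.update x i c.1) j c.2) := by
          simp only [Gate.inv, Gate.apply, Matrix.mul_apply, Finset.mul_sum, Finset.sum_mul,
            Function.update_self, hup, Function.update_of_ne h, Prod.mk.eta]
          rw [Finset.sum_comm]
          simp only [mul_assoc]
      _ = ψ x := by rw [hU]; simp [Matrix.one_apply]

/-- The inverse circuit. -/
def inverse (G : List (Gate ι)) : List (Gate ι) := (G.map Gate.inv).reverse

theorem circuit_inverse (G : List (Gate ι)) (ψ : State ι) :
    circuit (inverse G) (circuit G ψ) = ψ := by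
  induction G generalizing ψ with
  | nil => rfl
  | cons g G ih =>
    have h : inverse (g :: G) = inverse G ++ [g.inv] := by simp [inverse]
    rw [h, circuit_append, circuit_cons g G, ih, circuit_cons, Gate.inv_apply_apply, circuit_nil]

theorem length_inverse {ι : Type} (G : List (Gate ι)) : (inverse G).length = G.length := by
  simp [inverse]

/-- A linear map that permutes amplitudes by an involution `σ` acts on basis states as `σ`. -/
theorem ket_of_involutive {T : State ι → State ι} {σ : (ι → Bool) → (ι → Bool)}
    (hσ : Function.Involutive σ) (hT : ∀ ψ x, T ψ x = ψ (σ x)) (x : ι → Bool) :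
    T (ket x) = ket (σ x) := by
  funext z
  rw [hT]
  simp only [ket, Pi.single_apply, hσ.eq_iff]

/-! ### Elementary gates -/

/-- The matrix of the NOT gate. -/
def notMatrix : Matrix Bool Bool ℂ := Matrix.of fun a b => if a = b then 0 else 1

/-- The matrix of a square root of the NOT gate. -/
def sqrtNotMatrix : Matrix Bool Bool ℂ :=
  Matrix.of fun a b => if a = b then (1 + Complex.I) / 2 else (1 - Complex.I) / 2

/-- The matrix of the Hadamard gate. -/
def hadamardMatrix : Matrix Bool Bool ℂ :=
  Matrix.of fun a b => if a && b then -((1 / √2 : ℝ) : ℂ) else ((1 / √2 : ℝ) : ℂ)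

theorem inv_sqrt_two_mul_self : ((1 / √2 : ℝ) : ℂ) * ((1 / √2 : ℝ) : ℂ) = 1 / 2 := by
  rw [← Complex.ofReal_mul, div_mul_div_comm, Real.mul_self_sqrt (by norm_num)]
  norm_num

/-- The unitary of the NOT gate. -/
def notU : Matrix.unitaryGroup Bool ℂ := ⟨notMatrix, by
  rw [Matrix.mem_unitaryGroup_iff]
  ext a b
  cases a <;> cases b <;> simp [notMatrix, Matrix.mul_apply]⟩

/-- The unitary of a square root of the NOT gate. -/
def sqrtNotU : Matrix.unitaryGroup Bool ℂ := ⟨sqrtNotMatrix, by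
  rw [Matrix.mem_unitaryGroup_iff]
  ext a b
  cases a <;> cases b <;> simp [sqrtNotMatrix, Matrix.mul_apply] <;> ring_nf <;>
    simp [Complex.I_sq, Complex.conj_ofNat] <;> norm_num⟩

/-- The unitary of the Hadamard gate. -/
def hadamardU : Matrix.unitaryGroup Bool ℂ := ⟨hadamardMatrix, by
  rw [Matrix.mem_unitaryGroup_iff]
  have h := inv_sqrt_two_mul_self
  have hs : (starRingEnd ℂ) ((1 / √2 : ℝ) : ℂ) = ((1 / √2 : ℝ) : ℂ) := Complex.conj_ofReal _
  unfold hadamardMatrix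
  generalize ((1 / √2 : ℝ) : ℂ) = s at h hs
  ext a b
  cases a <;> cases b <;> simp [Matrix.mul_apply, hs, h]; norm_num⟩

/-- The unitary that applies `U` to the first qubit if the second one is set. -/
def controlledU (U : Matrix.unitaryGroup Bool ℂ) : Matrix.unitaryGroup (Bool × Bool) ℂ :=
  ⟨Matrix.blockDiagonal fun b => if b then (U : Matrix Bool Bool ℂ) else 1, by
    rw [Matrix.mem_unitaryGroup_iff, Matrix.star_eq_conjTranspose,
      Matrix.blockDiagonal_conjTranspose, ← Matrix.blockDiagonal_mul, ← Matrix.blockDiagonal_one]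
    congr 1
    funext b
    have hU := Matrix.mem_unitaryGroup_iff.1 U.2
    rw [Matrix.star_eq_conjTranspose] at hU
    cases b <;> simp [hU]⟩

/-- Apply `U` to the qubit `t` if the qubit `c` is set. -/
def controlled (c t : ι) (h : t ≠ c) (U : Matrix.unitaryGroup Bool ℂ) : Gate ι :=
  .two t c h (controlledU U)

theorem controlled_apply (c t : ι) (h : t ≠ c) (U : Matrix.unitaryGroup Bool ℂ) (ψ : State ι)
    (x : ι → Bool) :
    (controlled c t h U).apply ψ x = if x c then (Gate.one t U).apply ψ x else ψ x := by
  have hx : ∀ b, Function.update (Function.update x t b) c (x c) = Function.update x t b := by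
    intro b
    rw [Function.update_comm h]
    simp
  simp only [controlled, Gate.apply, controlledU, Fintype.sum_prod_type,
    Matrix.blockDiagonal_apply, ite_mul, zero_mul, Finset.sum_ite_eq, Finset.mem_univ, if_true, hx]
  cases x c <;> simp [Matrix.one_apply]

theorem Gate.one_apply (t : ι) (U : Matrix.unitaryGroup Bool ℂ) (ψ : State ι) (x : ι → Bool) :
    (Gate.one t U).apply ψ x =
      (U : Matrix Bool Bool ℂ) (x t) true * ψ (Function.update x t true) +
        (U : Matrix Bool Bool ℂ) (x t) false * ψ (Function.update x t false) := by
  exact Fintype.sum_bool _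

theorem notU_apply (a b : Bool) :
    (notU : Matrix Bool Bool ℂ) a b = if a = b then 0 else 1 := rfl

theorem sqrtNotU_apply (a b : Bool) : (sqrtNotU : Matrix Bool Bool ℂ) a b =
    if a = b then (1 + Complex.I) / 2 else (1 - Complex.I) / 2 := rfl

theorem hadamardU_apply (a b : Bool) : (hadamardU : Matrix Bool Bool ℂ) a b =
    if a && b then -((1 / √2 : ℝ) : ℂ) else ((1 / √2 : ℝ) : ℂ) := rfl

theorem one_notU_apply (t : ι) (ψ : State ι) (x : ι → Bool) :
    (Gate.one t notU).apply ψ x = ψ (Function.update x t (!x t)) := by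
  cases h : x t <;> simp [Gate.one_apply, notU_apply, h]

theorem not_ket (t : ι) (x : ι → Bool) :
    (Gate.one t notU).apply (ket x) = ket (Function.update x t (!x t)) :=
  ket_of_involutive (T := (Gate.one t notU).apply) (σ := fun x => Function.update x t (!x t))
    (fun x => by simp) (one_notU_apply t) x

/-- The controlled NOT gate. -/
def cnot (c t : ι) (h : t ≠ c) : Gate ι := controlled c t h notU

theorem cnot_apply (c t : ι) (h : t ≠ c) (ψ : State ι) (x : ι → Bool) :
    (cnot c t h).apply ψ x = ψ (Function.update x t (x t ^^ x c)) := by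
  rw [cnot, controlled_apply, one_notU_apply]
  cases hc : x c <;> simp

theorem cnot_ket (c t : ι) (h : t ≠ c) (x : ι → Bool) :
    (cnot c t h).apply (ket x) = ket (Function.update x t (x t ^^ x c)) :=
  ket_of_involutive (T := (cnot c t h).apply) (σ := fun x => Function.update x t (x t ^^ x c))
    (fun x => by simp [Function.update_of_ne h.symm]) (cnot_apply c t h) x

/-- The Toffoli gate, made of five two-qubit gates. -/
def toffoli (a b t : ι) (hab : a ≠ b) (hta : t ≠ a) (htb : t ≠ b) : List (Gate ι) :=
  [controlled b t htb sqrtNotU, cnot a b hab.symm, controlled b t htb sqrtNotU⁻¹,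
    cnot a b hab.symm, controlled a t hta sqrtNotU]

theorem sqrtNotU_inv_apply (a b : Bool) :
    ((sqrtNotU⁻¹ : Matrix.unitaryGroup Bool ℂ) : Matrix Bool Bool ℂ) a b =
      if a = b then (1 - Complex.I) / 2 else (1 + Complex.I) / 2 := by
  change (star sqrtNotMatrix) a b = _
  cases a <;> cases b <;> simp [sqrtNotMatrix] <;> ring

/-- With `V` the square root of NOT, the target receives `V` to the power `b - (a ⊕ b) + a`, which
equals `2ab`; so it is flipped exactly if both controls are set. The proof checks all values of the
three bits. -/
theorem toffoli_apply (a b t : ι) (hab : a ≠ b) (hta : t ≠ a) (htb : t ≠ b) (ψ : State ι)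
    (x : ι → Bool) :
    circuit (toffoli a b t hab hta htb) ψ x =
      ψ (Function.update x t (x t ^^ (x a && x b))) := by
  have hcomm : ∀ (y : ι → Bool) u v, Function.update (Function.update y b u) t v =
      Function.update (Function.update y t v) b u := fun y u v => Function.update_comm htb.symm u v y
  have hb : ∀ v, Function.update (Function.update x t v) b (x b) = Function.update x t v := by
    intro v
    rw [Function.update_comm htb]
    simp
  have hb' : Function.update x b (x b) = x := Function.update_eq_self b x
  have ht : Function.update x t (x t) = x := Function.update_eq_self t x
  have hI : Complex.I ^ 2 = -1 := Complex.I_sq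
  cases hxa : x a <;> cases hxb : x b <;> cases hxt : x t <;>
    rw [hxb] at hb hb' <;> rw [hxt] at ht <;>
    simp [toffoli, circuit_cons, controlled_apply, cnot_apply, Gate.one_apply, sqrtNotU_inv_apply,
      sqrtNotU_apply, Function.update_of_ne, htb, hta.symm, htb.symm, hab,
      hxa, hxb, hxt, hcomm, hb, hb', ht] <;>
    try (ring_nf; simp only [hI]; ring)

/-! ### Reversible classical circuits -/

/-- The Toffoli gate on three qubits, or nothing if they are not distinct. -/
def ccnot (a b t : ι) : List (Gate ι) :=
  if h : a ≠ b ∧ t ≠ a ∧ t ≠ b then toffoli a b t h.1 h.2.1 h.2.2 else []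

/-- The controlled NOT gate on two qubits, or nothing if they are not distinct. -/
def cnots (c t : ι) : List (Gate ι) := if h : t ≠ c then [cnot c t h] else []

omit [Fintype ι] in
theorem length_ccnot_le (a b t : ι) : (ccnot a b t).length ≤ 5 := by
  unfold ccnot
  split_ifs <;> simp [toffoli]

omit [Fintype ι] in
theorem length_cnots_le (c t : ι) : (cnots c t).length ≤ 1 := by
  unfold cnots
  split_ifs <;> simp

theorem circuit_ccnot {a b t : ι} (hab : a ≠ b) (hta : t ≠ a) (htb : t ≠ b) (x : ι → Bool) :
    circuit (ccnot a b t) (ket x) = ket (Function.update x t (x t ^^ (x a && x b))) := by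
  rw [ccnot, dif_pos ⟨hab, hta, htb⟩]
  exact ket_of_involutive (T := circuit (toffoli a b t hab hta htb))
    (σ := fun x => Function.update x t (x t ^^ (x a && x b)))
    (fun x => by simp [Function.update_of_ne hta.symm, Function.update_of_ne htb.symm])
    (toffoli_apply a b t hab hta htb) x

theorem circuit_cnots {c t : ι} (h : t ≠ c) (x : ι → Bool) :
    circuit (cnots c t) (ket x) = ket (Function.update x t (x t ^^ x c)) := by
  rw [cnots, dif_pos h, circuit_cons, cnot_ket, circuit_nil]

/-! ### Arithmetic by elementary gates -/

omit [DecidableEq ι] [Fintype ι] in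
theorem regVal_succ {w : ℕ} (r : Fin (w + 1) → ι) (x : ι → Bool) :
    regVal r x = (x (r 0)).toNat + 2 * regVal (fun i => r i.succ) x := by
  simp only [regVal, Fin.sum_univ_succ, Finset.mul_sum, Fin.val_zero, Fin.val_succ, pow_zero]
  congr 1
  · cases x (r 0) <;> rfl
  · refine Finset.sum_congr rfl fun i _ => ?_
    split_ifs <;> ring

omit [DecidableEq ι] [Fintype ι] in
theorem regVal_congr {w : ℕ} {r : Fin w → ι} {x y : ι → Bool} (h : ∀ i, x (r i) = y (r i)) :
    regVal r x = regVal r y := by simp [regVal, h]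

omit [DecidableEq ι] [Fintype ι] in
theorem testBit_regVal {w : ℕ} (r : Fin w → ι) (x : ι → Bool) (i : Fin w) :
    (regVal r x).testBit i = x (r i) := by
  induction w with
  | zero => exact i.elim0
  | succ w ih =>
    rw [regVal_succ]
    refine Fin.cases ?_ (fun j => ?_) i
    · cases x (r 0) <;> simp [Nat.testBit_zero]
    · rw [Fin.val_succ, Nat.testBit_succ, ← ih (fun i => r i.succ) j]
      congr 1
      cases x (r 0) <;> simp; omega

omit [DecidableEq ι] [Fintype ι] in
/-- A state that agrees with `x` outside the register `r` and whose register holds `N` modulo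
`2 ^ w` is the result of writing `N` to `r`. -/
theorem writeReg_eq {w : ℕ} {r : Fin w → ι} (hr : Function.Injective r) {x y : ι → Bool} {N : ℕ}
    (h : ∀ q, (∀ i, q ≠ r i) → y q = x q) (hN : regVal r y ≡ N [MOD 2 ^ w]) :
    writeReg r N x = y := by
  funext q
  by_cases hq : ∃ i, r i = q
  · obtain ⟨i, rfl⟩ := hq
    rw [writeReg, hr.extend_apply, ← testBit_regVal r y i]
    -- Bits below position `w` depend only on the residue modulo `2 ^ w`.
    have h2 : ∀ K : ℕ, K.testBit i = (K % 2 ^ w).testBit i := fun K => by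
      simp [Nat.testBit_mod_two_pow]
    rw [h2, h2 (regVal r y), hN]
  · rw [writeReg, Function.extend_apply' _ _ _ hq]
    exact (h q fun i hi => hq ⟨i, hi.symm⟩).symm

/-- Add the bit `t` to the register `c`, using carry qubits `h`. -/
def increment : (v : ℕ) → (t : ι) → (c h : Fin v → ι) → List (Gate ι)
  | 0, _, _, _ => []
  | v + 1, t, c, h =>
    ccnot t (c 0) (h 0) ++ (increment v (h 0) (fun i => c i.succ) (fun i => h i.succ) ++
      (ccnot t (c 0) (h 0) ++ cnots t (c 0)))

omit [Fintype ι] in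
theorem length_increment_le (v : ℕ) (t : ι) (c h : Fin v → ι) :
    (increment v t c h).length ≤ 11 * v := by
  induction v generalizing t with
  | zero => simp [increment]
  | succ v ih =>
    have h1 := ih (h 0) (fun i => c i.succ) (fun i => h i.succ)
    have h2 := length_ccnot_le t (c 0) (h 0)
    have h3 := length_cnots_le t (c 0)
    simp only [increment, List.length_append]
    omega

/-- The carry `t ∧ c 0` is stored in `h 0` and added recursively to the higher bits. It must be
erased before `c 0` is flipped, because erasing recomputes it from the old value of `c 0`. The carry
out of the top bit is lost, whence the congruence modulo `2 ^ v`. -/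
theorem circuit_increment (v : ℕ) (t : ι) (c h : Fin v → ι) (hc : Function.Injective c)
    (hh : Function.Injective h) (htc : ∀ i, t ≠ c i) (hth : ∀ i, t ≠ h i)
    (hch : ∀ i j, c i ≠ h j) (x : ι → Bool) (hx : ∀ i, x (h i) = false) :
    ∃ y, circuit (increment v t c h) (ket x) = ket y ∧ (∀ q, (∀ i, q ≠ c i) → y q = x q) ∧
      regVal c y ≡ regVal c x + (x t).toNat [MOD 2 ^ v] := by
  induction v generalizing t x with
  | zero => exact ⟨x, rfl, fun _ _ => rfl, by simp⟩
  | succ v ih =>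
    set x₁ : ι → Bool := Function.update x (h 0) (x t && x (c 0)) with hx₁
    obtain ⟨y₁, hy, hyc, hyv⟩ := ih (h 0) (fun i => c i.succ) (fun i => h i.succ)
      (fun i j hij => Fin.succ_injective _ (hc hij)) (fun i j hij => Fin.succ_injective _ (hh hij))
      (fun i => (hch i.succ 0).symm) (fun i hi => (Fin.succ_ne_zero i) (hh hi).symm)
      (fun i j => hch _ _) x₁ (fun i => by
        rw [hx₁, Function.update_of_ne (fun hi => (Fin.succ_ne_zero i) (hh hi))]
        exact hx _)
    have hy0 : y₁ (h 0) = (x t && x (c 0)) := by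
      rw [hyc _ (fun i => (hch i.succ 0).symm), hx₁, Function.update_self]
    have hyt : y₁ t = x t := by
      rw [hyc _ (fun i => htc i.succ), hx₁, Function.update_of_ne (hth 0)]
    have hyc0 : y₁ (c 0) = x (c 0) := by
      rw [hyc _ (fun i hi => (Fin.succ_ne_zero i) (hc hi).symm), hx₁,
        Function.update_of_ne (hch 0 0)]
    refine ⟨Function.update (Function.update y₁ (h 0) false) (c 0) (x (c 0) ^^ x t), ?_, ?_, ?_⟩
    · rw [increment, circuit_append, circuit_ccnot (htc 0) (hth 0).symm (hch 0 0).symm, hx 0,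
        Bool.false_xor, ← hx₁, circuit_append, hy, circuit_append,
        circuit_ccnot (htc 0) (hth 0).symm (hch 0 0).symm, circuit_cnots (htc 0).symm, hy0, hyt,
        hyc0, Bool.xor_self, Function.update_of_ne (hth 0), Function.update_of_ne (hch 0 0), hyt,
        hyc0]
    · intro q hq
      rw [Function.update_of_ne (hq 0)]
      by_cases hqh : q = h 0
      · rw [hqh, Function.update_self, hx]
      · rw [Function.update_of_ne hqh, hyc _ (fun i => hq i.succ), hx₁, Function.update_of_ne hqh]
    · have e1 : regVal (fun i => c i.succ)
          (Function.update (Function.update y₁ (h 0) false) (c 0) (x (c 0) ^^ x t)) =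
          regVal (fun i => c i.succ) y₁ := regVal_congr fun i => by
        rw [Function.update_of_ne (fun hi => (Fin.succ_ne_zero i) (hc hi)),
          Function.update_of_ne (hch _ _)]
      have e2 : regVal (fun i => c i.succ) x₁ = regVal (fun i => c i.succ) x :=
        regVal_congr fun i => by rw [hx₁, Function.update_of_ne (hch _ _)]
      rw [e2, hx₁, Function.update_self] at hyv
      rw [regVal_succ, regVal_succ c x, e1, Function.update_self, pow_succ']
      have := (Nat.ModEq.mul_left' 2 hyv).add_left (x (c 0) ^^ x t).toNat
      refine this.trans (congrArg (· % _) ?_)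
      cases x t <;> cases x (c 0) <;> simp <;> ring

/-- Add `2 ^ i` to the register `c` if the bit `t` is set, using carry qubits `h`. -/
def addPow : (i v : ℕ) → (t : ι) → (c h : Fin v → ι) → List (Gate ι)
  | 0, v, t, c, h => increment v t c h
  | _ + 1, 0, _, _, _ => []
  | i + 1, v + 1, t, c, h => addPow i v t (fun j => c j.succ) (fun j => h j.succ)

omit [Fintype ι] in
theorem length_addPow_le (i v : ℕ) (t : ι) (c h : Fin v → ι) :
    (addPow i v t c h).length ≤ 11 * v := by
  induction i generalizing v with
  | zero => exact length_increment_le v t c h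
  | succ i ih =>
    cases v with
    | zero => simp [addPow]
    | succ v => exact (ih v _ _).trans (by omega)

/-- Adding `2 ^ (i + 1)` keeps the lowest bit and adds `2 ^ i` to the number formed by the others.
If the register runs out of bits, the summand is zero modulo `2 ^ v`, so the empty circuit is
correct. -/
theorem circuit_addPow (i v : ℕ) (t : ι) (c h : Fin v → ι) (hc : Function.Injective c)
    (hh : Function.Injective h) (htc : ∀ i, t ≠ c i) (hth : ∀ i, t ≠ h i)
    (hch : ∀ i j, c i ≠ h j) (x : ι → Bool) (hx : ∀ i, x (h i) = false) :
    ∃ y, circuit (addPow i v t c h) (ket x) = ket y ∧ (∀ q, (∀ i, q ≠ c i) → y q = x q) ∧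
      regVal c y ≡ regVal c x + (x t).toNat * 2 ^ i [MOD 2 ^ v] := by
  induction i generalizing v with
  | zero => simpa [addPow] using circuit_increment v t c h hc hh htc hth hch x hx
  | succ i ih =>
    cases v with
    | zero => exact ⟨x, rfl, fun _ _ => rfl, by simp⟩
    | succ v =>
      obtain ⟨y, h1, h2, h3⟩ := ih v (fun j => c j.succ) (fun j => h j.succ)
        (fun i j hij => Fin.succ_injective _ (hc hij))
        (fun i j hij => Fin.succ_injective _ (hh hij)) (fun i => htc _) (fun i => hth _)
        (fun i j => hch _ _) (fun i => hx _)
      refine ⟨y, h1, fun q hq => h2 q fun i => hq _, ?_⟩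
      rw [regVal_succ, regVal_succ c x, h2 (c 0) fun i hi => (Fin.succ_ne_zero i) (hc hi).symm,
        pow_succ']
      refine ((Nat.ModEq.mul_left' 2 h3).add_left _).trans (congrArg (· % _) ?_)
      ring

/-- Circuits that each add a number to the register `c` together add the sum of these numbers. -/
theorem circuit_flatMap_add {α : Type} {v : ℕ} (c : Fin v → ι) (x : ι → Bool) (val : α → ℕ)
    (F : α → List (Gate ι))
    (hF : ∀ e y, (∀ q, (∀ i, q ≠ c i) → y q = x q) → ∃ z, circuit (F e) (ket y) = ket z ∧
      (∀ q, (∀ i, q ≠ c i) → z q = x q) ∧ regVal c z ≡ regVal c y + val e [MOD 2 ^ v])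
    (l : List α) (y : ι → Bool) (hy : ∀ q, (∀ i, q ≠ c i) → y q = x q) :
    ∃ z, circuit (l.flatMap F) (ket y) = ket z ∧ (∀ q, (∀ i, q ≠ c i) → z q = x q) ∧
      regVal c z ≡ regVal c y + (l.map val).sum [MOD 2 ^ v] := by
  induction l generalizing y with
  | nil => exact ⟨y, rfl, hy, by simpa using Nat.ModEq.refl _⟩
  | cons e l ih =>
    obtain ⟨z, h1, h2, h3⟩ := hF e y hy
    obtain ⟨z', h1', h2', h3'⟩ := ih z h2
    refine ⟨z', ?_, h2', ?_⟩
    · rw [List.flatMap_cons, circuit_append, h1, h1']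
    · rw [List.map_cons, List.sum_cons, ← add_assoc]
      exact h3'.trans (h3.add_right _)

theorem length_flatMap_le {α β : Type} (l : List α) (F : α → List β) (B : ℕ)
    (hF : ∀ e ∈ l, (F e).length ≤ B) : (l.flatMap F).length ≤ l.length * B := by
  induction l with
  | nil => simp
  | cons e l ih =>
    have h1 := hF e (by simp)
    have h2 := ih fun e he => hF e (by simp [he])
    rw [List.flatMap_cons, List.length_append, List.length_cons, add_mul]
    omega

omit [DecidableEq ι] [Fintype ι] in
theorem regVal_eq_sum {w : ℕ} (r : Fin w → ι) (x : ι → Bool) :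
    regVal r x = ((List.finRange w).map fun i => (x (r i)).toNat * 2 ^ (i : ℕ)).sum := by
  rw [← List.ofFn_eq_map, List.sum_ofFn, regVal]
  refine Finset.sum_congr rfl fun i _ => ?_
  cases x (r i) <;> simp

/-- The addition of two registers by elementary gates, with carry qubits `h`. -/
def addCircuit (w : ℕ) (a b h : Fin w → ι) : List (Gate ι) :=
  (List.finRange w).flatMap fun i : Fin w => addPow i w (a i) b h

omit [Fintype ι] in
theorem length_addCircuit_le (w : ℕ) (a b h : Fin w → ι) :
    (addCircuit w a b h).length ≤ w * (11 * w) :=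
  (length_flatMap_le (List.finRange w) (fun i : Fin w => addPow i w (a i) b h) (11 * w)
    fun i _ => length_addPow_le _ _ _ _ _).trans_eq (by rw [List.length_finRange])

theorem circuit_addCircuit (w : ℕ) (a b h : Fin w → ι) (hb : Function.Injective b)
    (hh : Function.Injective h) (hab : ∀ i j, a i ≠ b j) (hah : ∀ i j, a i ≠ h j)
    (hbh : ∀ i j, b i ≠ h j) (x : ι → Bool) (hx : ∀ i, x (h i) = false) :
    circuit (addCircuit w a b h) (ket x) = ket (writeReg b (regVal a x + regVal b x) x) := by
  obtain ⟨z, h1, h2, h3⟩ := circuit_flatMap_add b x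
    (fun i : Fin w => (x (a i)).toNat * 2 ^ (i : ℕ)) (fun i : Fin w => addPow i w (a i) b h)
    (fun i y hy => by
      obtain ⟨z, h1, h2, h3⟩ := circuit_addPow i w (a i) b h hb hh (hab i) (hah i) hbh y
        (fun j => by rw [hy _ fun k => (hbh k j).symm, hx])
      rw [hy _ (hab i)] at h3
      exact ⟨z, h1, fun q hq => (h2 q hq).trans (hy q hq), h3⟩)
    (List.finRange w) x (fun _ _ => rfl)
  rw [← regVal_eq_sum, add_comm] at h3
  rw [addCircuit, h1, writeReg_eq hb h2 h3]

/-- The multiplication of two registers into a third one by elementary gates, with carry qubits `h`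
and a qubit `t` for products of bits. -/
def mulCircuit (w v : ℕ) (a b : Fin w → ι) (c h : Fin v → ι) (t : ι) : List (Gate ι) :=
  (List.finRange w).flatMap fun i => (List.finRange w).flatMap fun j =>
    ccnot (a i) (b j) t ++ (addPow (i + j) v t c h ++ ccnot (a i) (b j) t)

omit [Fintype ι] in
theorem length_mulCircuit_le (w v : ℕ) (a b : Fin w → ι) (c h : Fin v → ι) (t : ι) :
    (mulCircuit w v a b c h t).length ≤ w * (w * (11 * v + 10)) := by
  have := length_flatMap_le (List.finRange w) (fun i => (List.finRange w).flatMap fun j =>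
    ccnot (a i) (b j) t ++ (addPow (i + j) v t c h ++ ccnot (a i) (b j) t)) (w * (11 * v + 10))
    fun i _ => by
      have := length_flatMap_le (List.finRange w) (fun j =>
        ccnot (a i) (b j) t ++ (addPow (i + j) v t c h ++ ccnot (a i) (b j) t)) (11 * v + 10)
        fun j _ => by
          have h1 := length_ccnot_le (a i) (b j) t
          have h2 := length_addPow_le (i + j) v t c h
          simp only [List.length_append]
          omega
      rwa [List.length_finRange] at this
  rwa [List.length_finRange] at this

/-- Schoolbook multiplication: `a b` is the sum of `a_i b_j 2 ^ (i + j)`. Each product bit is held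
in `t` while its power of two is added, and a second Toffoli gate clears `t`, since the factors have
not changed. -/
theorem circuit_mulCircuit (w v : ℕ) (a b : Fin w → ι) (c h : Fin v → ι) (t : ι)
    (hc : Function.Injective c) (hh : Function.Injective h) (hab : ∀ i j, a i ≠ b j)
    (hac : ∀ i j, a i ≠ c j) (hbc : ∀ i j, b i ≠ c j) (hta : ∀ i, t ≠ a i) (htb : ∀ i, t ≠ b i)
    (htc : ∀ i, t ≠ c i) (hth : ∀ i, t ≠ h i) (hch : ∀ i j, c i ≠ h j)
    (x : ι → Bool) (hx : ∀ i, x (h i) = false) (hxt : x t = false) :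
    circuit (mulCircuit w v a b c h t) (ket x) =
      ket (writeReg c (regVal c x + regVal a x * regVal b x) x) := by
  obtain ⟨z, h1, h2, h3⟩ := circuit_flatMap_add c x
    (fun i : Fin w => (x (a i)).toNat * 2 ^ (i : ℕ) * regVal b x)
    (fun i => (List.finRange w).flatMap fun j =>
      ccnot (a i) (b j) t ++ (addPow (i + j) v t c h ++ ccnot (a i) (b j) t))
    (fun i y hy => by
      obtain ⟨z, h1, h2, h3⟩ := circuit_flatMap_add c x
        (fun j : Fin w => (x (a i)).toNat * 2 ^ (i : ℕ) * ((x (b j)).toNat * 2 ^ (j : ℕ)))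
        (fun j => ccnot (a i) (b j) t ++ (addPow (i + j) v t c h ++ ccnot (a i) (b j) t))
        (fun j y hy => by
          set y₁ : ι → Bool := Function.update y t (x (a i) && x (b j)) with hy₁
          obtain ⟨z, h1, h2, h3⟩ := circuit_addPow (i + j) v t c h hc hh htc hth hch y₁
            (fun k => by
              rw [hy₁, Function.update_of_ne (hth k).symm, hy _ fun l => (hch l k).symm, hx])
          have hza : z (a i) = x (a i) := by
            rw [h2 _ (hac i), hy₁, Function.update_of_ne (hta i).symm, hy _ (hac i)]
          have hzb : z (b j) = x (b j) := by
            rw [h2 _ (hbc j), hy₁, Function.update_of_ne (htb j).symm, hy _ (hbc j)]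
          have hzt : z t = (x (a i) && x (b j)) := by
            rw [h2 _ htc, hy₁, Function.update_self]
          refine ⟨Function.update z t false, ?_, fun q hq => ?_, ?_⟩
          · rw [circuit_append, circuit_ccnot (hab i j) (hta i) (htb j), hy _ (hac i),
              hy _ (hbc j), hy _ htc, hxt, Bool.false_xor, ← hy₁, circuit_append, h1,
              circuit_ccnot (hab i j) (hta i) (htb j), hza, hzb, hzt, Bool.xor_self]
          · by_cases hqt : q = t
            · rw [hqt, Function.update_self, hxt]
            · rw [Function.update_of_ne hqt, h2 q hq, hy₁, Function.update_of_ne hqt, hy q hq]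
          · rw [regVal_congr (y := z) fun k => Function.update_of_ne (htc k).symm _ _]
            rw [regVal_congr (x := y₁) (y := y) fun k => by
              rw [hy₁, Function.update_of_ne (htc k).symm], hy₁, Function.update_self] at h3
            refine h3.trans (congrArg (· % _) ?_)
            cases x (a i) <;> cases x (b j) <;> simp [pow_add])
        (List.finRange w) y hy
      rw [List.sum_map_mul_left, ← regVal_eq_sum] at h3
      exact ⟨z, h1, h2, h3⟩)
    (List.finRange w) x (fun _ _ => rfl)
  rw [List.sum_map_mul_right, ← regVal_eq_sum] at h3
  rw [mulCircuit, h1, writeReg_eq hc h2 h3]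

/-! ### Simulation of arithmetic steps in a larger register -/

open Classical in
/-- The state `ψ` of the qubits in the range of `e`, with all other qubits as in the basis state
`|y⟩`. -/
def embed (e : ι → κ) (y : κ → Bool) : State ι →ₗ[ℂ] State κ where
  toFun ψ := fun z => if ∀ q, (∀ i, q ≠ e i) → z q = y q then ψ (fun i => z (e i)) else 0
  map_add' ψ φ := by
    funext z
    by_cases h : ∀ q, (∀ i, q ≠ e i) → z q = y q
    · simp only [Pi.add_apply, if_pos h]
    · simp only [Pi.add_apply, if_neg h, add_zero]
  map_smul' c ψ := by
    funext z
    by_cases h : ∀ q, (∀ i, q ≠ e i) → z q = y q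
    · simp only [Pi.smul_apply, RingHom.id_apply, if_pos h]
    · simp only [Pi.smul_apply, RingHom.id_apply, if_neg h, smul_zero]

omit [DecidableEq ι] in
open Classical in
theorem embed_apply (e : ι → κ) (y : κ → Bool) (ψ : State ι) (z : κ → Bool) : embed e y ψ z =
    if ∀ q, (∀ i, q ≠ e i) → z q = y q then ψ (fun i => z (e i)) else 0 := rfl

theorem embed_ket {e : ι → κ} (he : Function.Injective e) (y : κ → Bool) (x : ι → Bool) :
    embed e y (ket x) = ket (Function.extend e x y) := by
  funext z
  have : z = Function.extend e x y ↔
      (∀ q, (∀ i, q ≠ e i) → z q = y q) ∧ (fun i => z (e i)) = x := by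
    constructor
    · rintro rfl
      exact ⟨fun q hq => Function.extend_apply' _ _ _ fun ⟨i, hi⟩ => hq i hi.symm,
        funext fun i => he.extend_apply _ _ _⟩
    · rintro ⟨h1, rfl⟩
      funext q
      by_cases hq : ∃ i, e i = q
      · obtain ⟨i, rfl⟩ := hq
        rw [he.extend_apply]
      · rw [Function.extend_apply' _ _ _ hq, h1 q fun i hi => hq ⟨i, hi.symm⟩]
  rw [embed_apply]
  simp only [ket, Pi.single_apply, this, ite_and]

/-- A gate on qubits relabelled by `e`. -/
def Gate.map (e : ι → κ) (he : Function.Injective e) : Gate ι → Gate κ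
  | .one i U => .one (e i) U
  | .two i j h U => .two (e i) (e j) (he.ne h) U

theorem Gate.map_apply (e : ι → κ) (he : Function.Injective e) (y : κ → Bool) (g : Gate ι)
    (ψ : State ι) : (g.map e he).apply (embed e y ψ) = embed e y (g.apply ψ) := by
  -- A relabelled gate changes only qubits in the range of `e`, so the condition on all other qubits
  -- factors out of its sum.
  have hoff : ∀ (z : κ → Bool) i b, (∀ q, (∀ i, q ≠ e i) → Function.update z (e i) b q = y q) ↔
      ∀ q, (∀ i, q ≠ e i) → z q = y q := fun z i b =>
    forall_congr' fun q => forall_congr' fun hq => by rw [Function.update_of_ne (hq i)]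
  have hon : ∀ (z : κ → Bool) i b, (fun k => Function.update z (e i) b (e k)) =
      Function.update (fun k => z (e k)) i b := fun z i b =>
    Function.update_comp_eq_of_injective z he i b
  cases g <;> funext z <;> simp only [Gate.map, Gate.apply, embed_apply, hoff, hon] <;>
    split_ifs <;> simp

theorem state_eq_sum (ψ : State ι) : ψ = ∑ x, ψ x • ket x := by
  funext z
  simp [ket, Finset.sum_apply, Pi.single_apply]

theorem applyClassical_eq_sum (σ : (ι → Bool) → (ι → Bool)) (ψ : State ι) :
    applyClassical σ ψ = ∑ x, ψ x • ket (σ x) := by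
  funext z
  simp [applyClassical, ket, Finset.sum_apply, Pi.single_apply, eq_comm]

omit [DecidableEq ι] [Fintype ι] [DecidableEq κ] [Fintype κ] in
theorem writeReg_extend {e : ι → κ} (he : Function.Injective e) {w : ℕ} {r : Fin w → ι}
    (hr : Function.Injective r) (N : ℕ) (x : ι → Bool) (y : κ → Bool) :
    writeReg (fun i => e (r i)) N (Function.extend e x y) =
      Function.extend e (writeReg r N x) y := by
  have her : Function.Injective fun i => e (r i) := he.comp hr
  funext q
  by_cases hq : ∃ i, e i = q
  · obtain ⟨i, rfl⟩ := hq
    rw [he.extend_apply]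
    by_cases hi : ∃ k, r k = i
    · obtain ⟨k, rfl⟩ := hi
      rw [writeReg, writeReg, hr.extend_apply]
      exact her.extend_apply _ _ k
    · rw [writeReg, writeReg, Function.extend_apply' _ _ _ hi, Function.extend_apply',
        he.extend_apply]
      exact fun ⟨k, hk⟩ => hi ⟨k, he hk⟩
  · rw [Function.extend_apply' _ _ _ hq, writeReg, Function.extend_apply',
      Function.extend_apply' _ _ _ hq]
    exact fun ⟨k, hk⟩ => hq ⟨_, hk⟩

omit [DecidableEq ι] [Fintype ι] [DecidableEq κ] [Fintype κ] in
theorem regVal_extend {e : ι → κ} (he : Function.Injective e) {w : ℕ} (r : Fin w → ι)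
    (x : ι → Bool) (y : κ → Bool) :
    regVal (fun i => e (r i)) (Function.extend e x y) = regVal r x := by
  simp [regVal, he.extend_apply]

/-- By linearity, a circuit that is correct on basis states with clean ancillas is correct on every
superposition of them. This lets basis-state computations be used after arbitrary gates. -/
theorem circuit_embed_classical {e : ι → κ} (he : Function.Injective e) (y : κ → Bool)
    (σ : (ι → Bool) → (ι → Bool)) (G : List (Gate κ))
    (hG : ∀ x, circuit G (ket (Function.extend e x y)) = ket (Function.extend e (σ x) y))
    (ψ : State ι) : circuit G (embed e y ψ) = embed e y (applyClassical σ ψ) := by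
  conv_lhs => rw [state_eq_sum ψ]
  rw [applyClassical_eq_sum]
  simp only [map_sum, map_smul, embed_ket he, hG]

/-- The elementary gates that perform an arithmetic step on qubits relabelled by `e`, with carry
qubits `h` and a qubit `t` for products of bits. -/
def ArithOp.compile (e : ι → κ) (he : Function.Injective e) (h : ℕ → κ) (t : κ) :
    ArithOp ι → List (Gate κ)
  | .gate g => [g.map e he]
  | .add w a b _ => addCircuit w (fun i => e (a i)) (fun i => e (b i)) (fun i => h i)
  | .mul w v a b c _ =>
      mulCircuit w v (fun i => e (a i)) (fun i => e (b i)) (fun i => e (c i)) (fun i => h i) t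

omit [DecidableEq ι] [Fintype ι] [Fintype κ] in
theorem ArithOp.length_compile_le (e : ι → κ) (he : Function.Injective e) (h : ℕ → κ) (t : κ)
    (op : ArithOp ι) (W : ℕ) (hW : op.width ≤ W) :
    (op.compile e he h t).length ≤ 11 * (W + 1) ^ 3 := by
  cases op with
  | gate g =>
    have : 1 ≤ (W + 1) ^ 3 := Nat.one_le_pow _ _ (by omega)
    simp only [compile, List.length_singleton]
    omega
  | add w a b _ =>
    simp only [width] at hW
    refine (length_addCircuit_le _ _ _ _).trans ?_
    calc w * (11 * w) = w * (11 * w) * 1 := (mul_one _).symm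
      _ ≤ (W + 1) * (11 * (W + 1)) * (W + 1) := by gcongr <;> omega
      _ = _ := by ring
  | mul w v a b c _ =>
    simp only [width, max_le_iff] at hW
    refine (length_mulCircuit_le _ _ _ _ _ _ _).trans ?_
    calc w * (w * (11 * v + 10)) ≤ (W + 1) * ((W + 1) * (11 * (W + 1))) := by gcongr <;> omega
      _ = _ := by ring

/-- Every step leaves the carry qubits and `t` as it found them, namely in `|0⟩`; hence the
background `y` is the same before and after, and one set of `W` carry qubits serves all steps. -/
theorem ArithOp.circuit_compile (e : ι → κ) (he : Function.Injective e) (h : ℕ → κ) (t : κ)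
    (W : ℕ) (hh : ∀ i < W, ∀ j < W, h i = h j → i = j) (hth : ∀ i < W, t ≠ h i)
    (heh : ∀ q, ∀ i < W, e q ≠ h i) (het : ∀ q, t ≠ e q) (y : κ → Bool)
    (hy : ∀ i < W, y (h i) = false) (hyt : y t = false) (op : ArithOp ι) (hW : op.width ≤ W)
    (ψ : State ι) :
    circuit (op.compile e he h t) (embed e y ψ) = embed e y (op.apply ψ) := by
  have hxh : ∀ x, ∀ i < W, Function.extend e x y (h i) = false := fun x i hi => by
    rw [Function.extend_apply' _ _ _ fun ⟨q, hq⟩ => heh q i hi hq, hy i hi]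
  have hxt : ∀ x, Function.extend e x y t = false := fun x => by
    rw [Function.extend_apply' _ _ _ fun ⟨q, hq⟩ => het q hq.symm, hyt]
  cases op with
  | gate g => exact Gate.map_apply e he y g ψ
  | add w a b hab =>
    simp only [width] at hW
    obtain ⟨-, hb, hab⟩ := Sum.elim_injective.1 hab
    refine circuit_embed_classical he y _ _ (fun x => ?_) ψ
    rw [compile, circuit_addCircuit, regVal_extend he, regVal_extend he, writeReg_extend he hb]
    · exact he.comp hb
    · exact fun i j hij => Fin.ext (hh i (by omega) j (by omega) hij)
    · exact fun i j hij => hab i j (he hij)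
    · exact fun i j => heh _ _ (by omega)
    · exact fun i j => heh _ _ (by omega)
    · exact fun i => hxh x i (by omega)
  | mul w v a b c habc =>
    simp only [width, max_le_iff] at hW
    obtain ⟨-, hbc, hac⟩ := Sum.elim_injective.1 habc
    obtain ⟨-, hc, hbc⟩ := Sum.elim_injective.1 hbc
    refine circuit_embed_classical he y _ _ (fun x => ?_) ψ
    rw [compile, circuit_mulCircuit, regVal_extend he, regVal_extend he, regVal_extend he,
      writeReg_extend he hc]
    · exact he.comp hc
    · exact fun i j hij => Fin.ext (hh i (by omega) j (by omega) hij)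
    · exact fun i j hij => hac i (Sum.inl j) (he hij)
    · exact fun i j hij => hac i (Sum.inr j) (he hij)
    · exact fun i j hij => hbc i j (he hij)
    · exact fun i => het _
    · exact fun i => het _
    · exact fun i => het _
    · exact fun i => hth _ (by omega)
    · exact fun i j => heh _ _ (by omega)
    · exact fun i => hxh x i (by omega)
    · exact hxt x

/-- The elementary gates that perform a list of arithmetic steps. -/
def compile (e : ι → κ) (he : Function.Injective e) (h : ℕ → κ) (t : κ) (P : List (ArithOp ι)) :
    List (Gate κ) := P.flatMap (ArithOp.compile e he h t)

omit [DecidableEq ι] [Fintype ι] [Fintype κ] in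
theorem length_compile_le (e : ι → κ) (he : Function.Injective e) (h : ℕ → κ) (t : κ)
    (P : List (ArithOp ι)) (W : ℕ) (hW : ∀ op ∈ P, op.width ≤ W) :
    (compile e he h t P).length ≤ P.length * (11 * (W + 1) ^ 3) :=
  length_flatMap_le _ _ _ fun op hop => op.length_compile_le e he h t W (hW op hop)

theorem circuit_compile (e : ι → κ) (he : Function.Injective e) (h : ℕ → κ) (t : κ)
    (W : ℕ) (hh : ∀ i < W, ∀ j < W, h i = h j → i = j) (hth : ∀ i < W, t ≠ h i)
    (heh : ∀ q, ∀ i < W, e q ≠ h i) (het : ∀ q, t ≠ e q) (y : κ → Bool)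
    (hy : ∀ i < W, y (h i) = false) (hyt : y t = false) (P : List (ArithOp ι))
    (hW : ∀ op ∈ P, op.width ≤ W) (ψ : State ι) :
    circuit (compile e he h t P) (embed e y ψ) = embed e y (runArith P ψ) := by
  induction P generalizing ψ with
  | nil => rfl
  | cons op P ih =>
    rw [compile, List.flatMap_cons, circuit_append,
      ArithOp.circuit_compile e he h t W hh hth heh het y hy hyt op (hW op (by simp))]
    exact ih (fun op hop => hW op (by simp [hop])) _

variable {n m k : ℕ}

/-! ### Linearity of quantum algorithms -/

/-- An instruction as a linear map. -/
def Instr.toLin (U : OracleUnitary n m) (c : Instr n m k) :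
    State (Wire n m k) →ₗ[ℂ] State (Wire n m k) where
  toFun := c.apply U
  map_add' ψ φ := by
    cases c with
    | gate g => exact g.toLin.map_add ψ φ
    | oracleInv =>
      funext x
      simp [Instr.apply, mul_add, Finset.sum_add_distrib]
    | measure i o =>
      funext x
      by_cases h : x i = o <;> simp [Instr.apply, h]
  map_smul' a ψ := by
    cases c with
    | gate g => exact g.toLin.map_smul a ψ
    | oracleInv =>
      funext x
      simp only [Instr.apply, Pi.smul_apply, smul_eq_mul, RingHom.id_apply, Finset.mul_sum]
      exact Finset.sum_congr rfl fun b _ => by ring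
    | measure i o =>
      funext x
      by_cases h : x i = o <;> simp [Instr.apply, h]

/-- The linear map of a quantum algorithm. -/
def runLin (U : OracleUnitary n m) :
    List (Instr n m k) → State (Wire n m k) →ₗ[ℂ] State (Wire n m k)
  | [] => LinearMap.id
  | c :: A => runLin U A ∘ₗ c.toLin U

theorem runLin_nil (U : OracleUnitary n m) (ψ : State (Wire n m k)) : runLin U [] ψ = ψ := rfl

theorem runLin_cons (U : OracleUnitary n m) (c : Instr n m k) (A : List (Instr n m k))
    (ψ : State (Wire n m k)) : runLin U (c :: A) ψ = runLin U A (c.apply U ψ) := rfl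

theorem runLin_append (U : OracleUnitary n m) (A B : List (Instr n m k))
    (ψ : State (Wire n m k)) : runLin U (A ++ B) ψ = runLin U B (runLin U A ψ) := by
  induction A generalizing ψ with
  | nil => rfl
  | cons c A ih => simp [runLin_cons, ih]

theorem run_eq_runLin (A : Algorithm n m k) (U : OracleUnitary n m) (ψ : State (Wire n m k)) :
    A.run U ψ = runLin U A ψ := by
  unfold Algorithm.run
  induction A generalizing ψ with
  | nil => rfl
  | cons c A ih => exact ih _

/-- A list of gates as a quantum algorithm. -/
def gates (G : List (Gate (Wire n m k))) : List (Instr n m k) := G.map Instr.gate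

theorem runLin_gates (U : OracleUnitary n m) (G : List (Gate (Wire n m k)))
    (ψ : State (Wire n m k)) : runLin U (gates G) ψ = circuit G ψ := by
  induction G generalizing ψ with
  | nil => rfl
  | cons g G ih => exact ih _

theorem measure_ket (U : OracleUnitary n m) (i : Wire n m k) (o : Bool)
    (x : Wire n m k → Bool) :
    (Instr.measure i o).apply U (ket x) = if x i = o then ket x else 0 := by
  funext z
  by_cases hz : z = x
  · subst hz
    by_cases h : z i = o <;> simp [Instr.apply, h]
  · have h0 : ket x z = 0 := by simp [ket, hz]
    by_cases h : x i = o <;> simp [Instr.apply, h0, h]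

/-- Only the columns of `U` at an empty data register are known. Unitarity turns them into the
values of `U⁻¹` at the states `|j⟩|d_j⟩`, and no other values are needed. -/
theorem oracleInv_ket {U : OracleUnitary n m} {d : (Fin n → Bool) → (Fin m → Bool)}
    (hU : IsDigitalEncoding d U) (j : Fin n → Bool) (z : Fin k → Bool) :
    (Instr.oracleInv : Instr n m k).apply U (ket (join j (d j) z)) =
      ket (join j (zeros (Fin m)) z) := by
  have hinv : Matrix.mulVec ((U⁻¹).1) (Pi.single (j, d j) 1) =
      Pi.single (j, zeros (Fin m)) 1 := by
    rw [← hU j, Matrix.mulVec_mulVec]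
    have h1 : (U⁻¹).1 * U.1 = 1 := congrArg Subtype.val (inv_mul_cancel U)
    rw [h1, Matrix.one_mulVec]
  have hjoin : ∀ (x : Wire n m k → Bool) a b c, x = join a b c ↔
      ((fun i => x (Sum.inl i), fun i => x (Sum.inr (Sum.inl i))) = (a, b)) ∧
        (fun i => x (Sum.inr (Sum.inr i))) = c := by
    intro x a b c
    constructor
    · rintro rfl
      exact ⟨rfl, rfl⟩
    · rintro ⟨h1, rfl⟩
      obtain ⟨rfl, rfl⟩ := Prod.mk.inj h1
      funext i
      rcases i with i | i | i <;> rfl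
  funext x
  have hx := congrFun hinv (fun i => x (Sum.inl i), fun i => x (Sum.inr (Sum.inl i)))
  simp only [Matrix.mulVec, dotProduct] at hx
  calc _ = ∑ y : (Fin n → Bool) × (Fin m → Bool),
          (U⁻¹).1 (fun i => x (Sum.inl i), fun i => x (Sum.inr (Sum.inl i))) y *
            ket (join j (d j) z) (join y.1 y.2 (fun i => x (Sum.inr (Sum.inr i)))) := rfl
    _ = if (fun i => x (Sum.inr (Sum.inr i))) = z then
          (Pi.single (j, zeros (Fin m)) 1 : (Fin n → Bool) × (Fin m → Bool) → ℂ)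
            (fun i => x (Sum.inl i), fun i => x (Sum.inr (Sum.inl i))) else 0 := by
        rw [← hx]
        split_ifs with h
        · refine Finset.sum_congr rfl fun y _ => ?_
          congr 1
          simp only [ket, Pi.single_apply]
          refine if_congr ((hjoin _ _ _ _).trans ?_) rfl rfl
          exact ⟨fun h => h.1, fun h' => ⟨h', h⟩⟩
        · refine Finset.sum_eq_zero fun y _ => ?_
          have : join y.1 y.2 (fun i => x (Sum.inr (Sum.inr i))) ≠ join j (d j) z :=
            fun h' => h ((hjoin _ _ _ _).1 h').2
          simp [ket, this]
    _ = _ := by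
        simp only [ket, Pi.single_apply, hjoin x, ite_and]
        split_ifs <;> rfl

/-! ### Digital-to-analog conversion -/

section Hadamard

variable {ι : Type} [DecidableEq ι] [Fintype ι]

/-- The Hadamard gate. -/
def hadamard (i : ι) : Gate ι := .one i hadamardU

/-- A normal form that separates bit `i` from the others, so that identities for Hadamard gates
become a case check on `z i`. -/
theorem ket_update_apply (x z : ι → Bool) (i : ι) (b : Bool) :
    ket (Function.update x i b) z =
      if z i = b then ket (Function.update x i false) (Function.update z i false) else 0 := by
  by_cases hb : z i = b
  · subst hb
    rw [if_pos rfl]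
    simp only [ket, Pi.single_apply]
    refine if_congr ⟨fun h => ?_, fun h => ?_⟩ rfl rfl
    · rw [h]
      simp
    · have := congrArg (fun u => Function.update u i (z i)) h
      simpa using this
  · rw [if_neg hb]
    have : z ≠ Function.update x i b := fun h => hb (by rw [h, Function.update_self])
    simp [ket, this]

theorem hadamard_ket_false (i : ι) (x : ι → Bool) :
    (hadamard i).apply (ket (Function.update x i false)) =
      ((1 / √2 : ℝ) : ℂ) • (ket (Function.update x i false) + ket (Function.update x i true)) := by
  funext z
  rw [hadamard, Gate.one_apply, Pi.smul_apply, Pi.add_apply, ket_update_apply x _ i false,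
    ket_update_apply x (Function.update z i false) i false, ket_update_apply x z i false,
    ket_update_apply x z i true]
  cases z i <;> simp [hadamardU_apply]

theorem hadamard_ket_true (i : ι) (x : ι → Bool) :
    (hadamard i).apply (ket (Function.update x i true)) =
      ((1 / √2 : ℝ) : ℂ) • (ket (Function.update x i false) - ket (Function.update x i true)) := by
  funext z
  rw [hadamard, Gate.one_apply, Pi.smul_apply, Pi.sub_apply, ket_update_apply x _ i true,
    ket_update_apply x (Function.update z i false) i true, ket_update_apply x z i false,
    ket_update_apply x z i true]
  cases z i <;> simp [hadamardU_apply]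

end Hadamard

/-- The value is the average of the leading digit and the value of the remaining digits; `dac`
realizes this average with one Hadamard pair. -/
theorem fracVal_succ {R : ℕ} (b : Fin (R + 1) → Bool) :
    fracVal b = ((if b 0 then 1 else 0) + fracVal fun i => b i.succ) / 2 := by
  simp only [fracVal, Fin.sum_univ_succ, Fin.val_zero, Fin.val_succ, add_div, Finset.sum_div]
  congr 1
  · split_ifs <;> norm_num
  · refine Finset.sum_congr rfl fun i _ => ?_
    split_ifs
    · rw [pow_succ]
      ring
    · simp

/-- The digital-to-analog conversion of the register `c`, controlled by the qubit `q`: each basis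
state in which `q` is set is multiplied by the number that `c` represents. -/
def dac : (R : ℕ) → (q s : Wire n m k) → (c y t : Fin R → Wire n m k) → List (Instr n m k)
  | 0, q, _, _, _, _ => [.measure q false]
  | R + 1, q, s, c, y, t =>
    .gate (hadamard (y 0)) ::
      ((gates (ccnot q (y 0) (t 0)) ++
        (dac R (t 0) s (fun i => c i.succ) (fun i => y i.succ) (fun i => t i.succ) ++
          (gates (cnots q (t 0) ++ (cnots (t 0) s ++ ccnot (t 0) (c 0) s)) ++
            .measure s false :: gates (cnots q (t 0) ++ ccnot q (y 0) (t 0))))) ++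
        [.gate (hadamard (y 0)), .measure (y 0) false])

theorem length_dac_le (R : ℕ) (q s : Wire n m k) (c y t : Fin R → Wire n m k) :
    (dac R q s c y t).length ≤ 22 * R + 1 := by
  induction R generalizing q with
  | zero => simp [dac]
  | succ R ih =>
    have h0 := ih (t 0) (fun i => c i.succ) (fun i => y i.succ) (fun i => t i.succ)
    have h1 := length_ccnot_le q (y 0) (t 0)
    have h2 := length_cnots_le q (t 0)
    have h3 := length_cnots_le (t 0) s
    have h4 := length_ccnot_le (t 0) (c 0) s
    simp only [dac, gates, List.length_append, List.length_cons, List.length_map,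
      List.length_nil]
    omega

/-- The Hadamard gates on `y 0` and the projection onto `y 0 = 0` average the factors of two
branches. If `q` is set, the branch `y 0 = 1` recurses on the remaining digits and the branch `y 0 =
0` survives exactly if the leading digit is set, so the average is that of `fracVal_succ`. If `q` is
not set, both factors are 1. The control `q` is what confines the recursive call to one branch. With
no digits left, demanding `q = 0` gives the factor 0 to a set control. -/
theorem runLin_dac (U : OracleUnitary n m) (R : ℕ) (q s : Wire n m k)
    (c y t : Fin R → Wire n m k) (hqs : q ≠ s) (hqc : ∀ i, q ≠ c i) (hqy : ∀ i, q ≠ y i)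
    (hqt : ∀ i, q ≠ t i) (hsc : ∀ i, s ≠ c i) (hsy : ∀ i, s ≠ y i) (hst : ∀ i, s ≠ t i)
    (hcy : ∀ i j, c i ≠ y j) (hct : ∀ i j, c i ≠ t j) (hyt : ∀ i j, y i ≠ t j)
    (hy : Function.Injective y) (ht : Function.Injective t) (x : Wire n m k → Bool)
    (hxs : x s = false) (hxy : ∀ i, x (y i) = false) (hxt : ∀ i, x (t i) = false) :
    runLin U (dac R q s c y t) (ket x) =
      ((if x q then fracVal (fun i => x (c i)) else 1 : ℝ) : ℂ) • ket x := by
  induction R generalizing q x with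
  | zero =>
    rw [dac, runLin_cons, runLin_nil, measure_ket]
    cases x q <;> simp [fracVal]
  | succ R ih =>
    -- Between the two Hadamard gates the algorithm acts diagonally on the basis states with clean
    -- scratch qubits.
    have hmid : ∀ x : Wire n m k → Bool, x s = false → (∀ i : Fin R, x (y i.succ) = false) →
        (∀ i, x (t i) = false) →
        runLin U (gates (ccnot q (y 0) (t 0)) ++
          (dac R (t 0) s (fun i => c i.succ) (fun i => y i.succ) (fun i => t i.succ) ++
            (gates (cnots q (t 0) ++ (cnots (t 0) s ++ ccnot (t 0) (c 0) s)) ++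
              .measure s false :: gates (cnots q (t 0) ++ ccnot q (y 0) (t 0))))) (ket x) =
        ((if x q then if x (y 0) then fracVal (fun i => x (c i.succ))
          else if x (c 0) then 1 else 0 else 1 : ℝ) : ℂ) • ket x := by
      intro x hxs hxy hxt
      -- Only `t 0` and `s` vary here, so two bits describe the state. The qubit `t 0` holds first
      -- `q ∧ y 0`, the control of the recursive call, then `q ∧ ¬ y 0`; the flag `s` becomes `t 0 ∧
      -- ¬ c 0` and is demanded to be 0, so it needs no uncomputation.
      set X : Bool → Bool → Wire n m k → Bool :=
        fun T S => Function.update (Function.update x (t 0) T) s S with hX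
      have X0 : x = X false false := by
        rw [hX]
        simp only
        have h1 : Function.update x (t 0) false = x :=
          Function.update_eq_self_iff.2 (hxt 0).symm
        rw [h1, Function.update_eq_self_iff.2 hxs.symm]
      have Xs : ∀ T S, X T S s = S := fun T S => by simp [hX]
      have Xt : ∀ T S, X T S (t 0) = T := fun T S => by simp [hX, (hst 0).symm]
      have Xo : ∀ T S p, p ≠ t 0 → p ≠ s → X T S p = x p := fun T S p h1 h2 => by
        simp [hX, h1, h2]
      have Xus : ∀ T S S', Function.update (X T S) s S' = X T S' := fun T S S' => by simp [hX]
      have Xut : ∀ T S T', Function.update (X T S) (t 0) T' = X T' S := fun T S T' => by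
        simp only [hX]
        rw [Function.update_comm (hst 0)]
        simp
      have Xq : ∀ T S, X T S q = x q := fun T S => Xo T S q (hqt 0) hqs
      have Xy : ∀ T S, X T S (y 0) = x (y 0) := fun T S => Xo T S _ (hyt 0 0) (hsy 0).symm
      have Xc : ∀ T S i, X T S (c i) = x (c i) := fun T S i => Xo T S _ (hct i 0) (hsc i).symm
      have c1 : ∀ T S, circuit (ccnot q (y 0) (t 0)) (ket (X T S)) =
          ket (X (T ^^ (x q && x (y 0))) S) := fun T S => by
        rw [circuit_ccnot (hqy 0) (hqt 0).symm (hyt 0 0).symm, Xut, Xt, Xq, Xy]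
      have c2 : ∀ T S, circuit (cnots q (t 0)) (ket (X T S)) = ket (X (T ^^ x q) S) :=
        fun T S => by rw [circuit_cnots (hqt 0).symm, Xut, Xt, Xq]
      have c3 : ∀ T S, circuit (cnots (t 0) s) (ket (X T S)) = ket (X T (S ^^ T)) :=
        fun T S => by rw [circuit_cnots (hst 0), Xus, Xt, Xs]
      have c4 : ∀ T S, circuit (ccnot (t 0) (c 0) s) (ket (X T S)) =
          ket (X T (S ^^ (T && x (c 0)))) := fun T S => by
        rw [circuit_ccnot (hct 0 0).symm (hst 0) (hsc 0), Xus, Xt, Xs, Xc]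
      have c5 : ∀ T, runLin U (dac R (t 0) s (fun i => c i.succ) (fun i => y i.succ)
          (fun i => t i.succ)) (ket (X T false)) =
          ((if T then fracVal (fun i => x (c i.succ)) else 1 : ℝ) : ℂ) • ket (X T false) := by
        intro T
        rw [ih (t 0) (fun i => c i.succ) (fun i => y i.succ) (fun i => t i.succ) (hst 0).symm
          (fun i => (hct _ _).symm) (fun i => (hyt _ _).symm)
          (fun i h => Fin.succ_ne_zero i (ht h).symm) (fun i => hsc _) (fun i => hsy _)
          (fun i => hst _) (fun i j => hcy _ _) (fun i j => hct _ _) (fun i j => hyt _ _)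
          (fun i j h => Fin.succ_injective _ (hy h)) (fun i j h => Fin.succ_injective _ (ht h))
          (X T false) (Xs _ _) (fun i => by rw [Xo _ _ _ (hyt _ _) (hsy _).symm, hxy])
          (fun i => by rw [Xo _ _ _ (fun h => Fin.succ_ne_zero i (ht h)) (hst _).symm, hxt]), Xt]
        simp only [Xc]
      have c6 : ∀ T S, (Instr.measure s false).apply U (ket (X T S)) =
          if S then 0 else ket (X T S) := fun T S => by
        rw [measure_ket, Xs]
        cases S <;> simp
      conv_lhs => rw [X0]
      conv_rhs => rw [X0, Xq, Xy]
      simp only [Xc]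
      rw [runLin_append, runLin_gates, c1, Bool.false_xor, runLin_append, c5, map_smul,
        runLin_append, runLin_gates, circuit_append, c2, circuit_append, c3, c4, runLin_cons, c6]
      cases hq : x q <;> cases hy0 : x (y 0) <;> cases x (c 0) <;>
        simp [runLin_gates, circuit_append, c1, c2, hq, hy0]
    have hx0 : x = Function.update x (y 0) false := by
      conv_rhs => rw [← hxy 0, Function.update_eq_self]
    have hx1 : ∀ p, p ≠ y 0 → Function.update x (y 0) true p = x p := fun p hp =>
      Function.update_of_ne hp _ _
    have h0 := hmid x hxs (fun i => hxy _) hxt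
    have h1 := hmid (Function.update x (y 0) true) (by rw [hx1 _ (hsy 0), hxs])
      (fun i => by rw [hx1 _ (fun h => Fin.succ_ne_zero i (hy h)), hxy])
      (fun i => by rw [hx1 _ (hyt 0 i).symm, hxt])
    rw [hx1 _ (hqy 0), Function.update_self, hx1 _ (hcy 0 0)] at h1
    simp only [hx1 _ (hcy _ 0)] at h1
    rw [hxy 0] at h0
    have e1 : (hadamard (y 0)).apply (ket x) =
        ((1 / √2 : ℝ) : ℂ) • (ket x + ket (Function.update x (y 0) true)) := by
      have := hadamard_ket_false (y 0) x
      rwa [← hx0] at this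
    have e2 : (hadamard (y 0)).apply (ket (Function.update x (y 0) true)) =
        ((1 / √2 : ℝ) : ℂ) • (ket x - ket (Function.update x (y 0) true)) := by
      have := hadamard_ket_true (y 0) x
      rwa [← hx0] at this
    have m1 : (Instr.measure (y 0) false).toLin U (ket x) = ket x := by
      change (Instr.measure (y 0) false).apply U (ket x) = _
      rw [measure_ket, hxy, if_pos rfl]
    have m2 : (Instr.measure (y 0) false).toLin U (ket (Function.update x (y 0) true)) = 0 := by
      change (Instr.measure (y 0) false).apply U _ = _
      rw [measure_ket, Function.update_self, if_neg (by simp)]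
    -- Both branches end in `|x⟩` with the same factor `1 / √2`; with the `1 / √2` of the first
    -- Hadamard gate this gives the average.
    have e3 : runLin U [.gate (hadamard (y 0)), .measure (y 0) false] (ket x) =
        ((1 / √2 : ℝ) : ℂ) • ket x := by
      change (Instr.measure (y 0) false).toLin U ((hadamard (y 0)).apply (ket x)) = _
      rw [e1, map_smul, map_add, m1, m2, add_zero]
    have e4 : runLin U [.gate (hadamard (y 0)), .measure (y 0) false]
        (ket (Function.update x (y 0) true)) = ((1 / √2 : ℝ) : ℂ) • ket x := by
      change (Instr.measure (y 0) false).toLin U ((hadamard (y 0)).apply (ket _)) = _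
      rw [e2, map_smul, map_sub, m1, m2, sub_zero]
    rw [dac, runLin_cons]
    change runLin U _ ((hadamard (y 0)).apply (ket x)) = _
    rw [e1, runLin_append, map_smul, map_add, h0, h1, map_smul, map_add, map_smul, map_smul, e3,
      e4, smul_smul, smul_smul, ← add_smul, smul_smul]
    congr 1
    rw [fracVal_succ]
    have hs := inv_sqrt_two_mul_self
    generalize ((1 / √2 : ℝ) : ℂ) = a at hs
    generalize fracVal (fun i => x (c i.succ)) = f
    cases x q <;> cases x (c 0) <;> simp
    · linear_combination 2 * hs
    · linear_combination 2 * hs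
    · linear_combination (f : ℂ) * hs
    · linear_combination (1 + (f : ℂ)) * hs

/-! ### Binary fractions -/

theorem fracVal_append {R u : ℕ} (b : Fin (R + u) → Bool) :
    fracVal b = fracVal (fun i => b (Fin.castAdd u i)) +
      (1 / 2) ^ R * fracVal (fun i => b (Fin.natAdd R i)) := by
  simp only [fracVal, Fin.sum_univ_add, Finset.mul_sum, Fin.val_castAdd, Fin.val_natAdd, mul_ite,
    mul_zero, ← pow_add, add_assoc]

theorem fracVal_nonneg {R : ℕ} (b : Fin R → Bool) : 0 ≤ fracVal b :=
  Finset.sum_nonneg fun i _ => by split_ifs <;> positivity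

theorem fracVal_le_one {R : ℕ} (b : Fin R → Bool) : fracVal b ≤ 1 := by
  induction R with
  | zero => simp [fracVal]
  | succ R ih =>
    rw [fracVal_succ]
    have := ih fun i => b i.succ
    split_ifs <;> linarith

theorem fracVal_zeros (R : ℕ) : fracVal (zeros (Fin R)) = 0 := by simp [fracVal, zeros]

theorem fracVal_append_zeros {R u : ℕ} (b : Fin R → Bool) :
    fracVal (Fin.append b (zeros (Fin u))) = fracVal b := by
  rw [fracVal_append]
  simp only [Fin.append_left, Fin.append_right]
  rw [show (fun i => zeros (Fin u) i) = zeros (Fin u) from rfl, fracVal_zeros]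
  simp

/-- Cutting a binary fraction to at least `M` bits, or not at all, changes it by at most
`2 ^ (-M)`. -/
theorem abs_fracVal_castLE_sub_le {R r M : ℕ} (hR : R ≤ r) (h : R = r ∨ R = M)
    (b : Fin r → Bool) :
    |fracVal (fun i => b (Fin.castLE hR i)) - fracVal b| ≤ (1 / 2) ^ M := by
  obtain ⟨u, rfl⟩ := Nat.exists_eq_add_of_le hR
  rw [fracVal_append b]
  change |fracVal (fun i => b (Fin.castAdd u i)) - _| ≤ _
  rw [sub_add_cancel_left, abs_neg]
  have h0 := fracVal_nonneg fun i => b (Fin.natAdd R i)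
  have h1 := fracVal_le_one fun i => b (Fin.natAdd R i)
  rw [abs_of_nonneg (by positivity)]
  rcases h with h | h
  · obtain rfl : u = 0 := by omega
    simp [fracVal]
  · subst h
    exact mul_le_of_le_one_right (by positivity) h1

/-! ### The complete algorithm -/

variable {n m k : ℕ}

theorem countP_isOracle_gates (G : List (Gate (Wire n m k))) :
    (gates G).countP (fun c => c.isOracle) = 0 := by
  simp [gates, List.countP_eq_zero, Instr.isOracle]

theorem countP_isOracle_dac (R : ℕ) (q s : Wire n m k) (c y t : Fin R → Wire n m k) :
    (dac R q s c y t).countP (fun c => c.isOracle) = 0 := by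
  induction R generalizing q with
  | zero => simp [dac, Instr.isOracle]
  | succ R ih =>
    simp only [dac, List.countP_append, List.countP_cons, List.countP_nil, countP_isOracle_gates, ih]
    rfl

/-- The ancilla qubits: padding of the input, result and work qubits of the arithmetic steps, then
carry qubits, two qubits for each digit of the result, and three more qubits. -/
abbrev Ancilla (t r s W R : ℕ) : Type :=
  (Fin t ⊕ (Fin r ⊕ Fin s)) ⊕ (Fin W ⊕ (Fin R ⊕ (Fin R ⊕ Fin 3)))

/-- From arithmetic steps that compute `g`, one obtains a quantum algorithm that multiplies the
amplitude of each address by the number represented by the first bits of `g`. -/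
theorem exists_algorithm {m t r s W R : ℕ} (hR : R ≤ r) (P : List (ArithOp (Wire (m + t) r s)))
    (hW : ∀ op ∈ P, op.width ≤ W) (g : (Fin (m + t) → Bool) → (Fin r → Bool))
    (hP : ∀ a, runArith P (ket (join a (zeros (Fin r)) (zeros (Fin s)))) =
      ket (join a (g a) (zeros (Fin s)))) (n : ℕ) :
    ∃ (k : ℕ) (A : Algorithm n m k),
      A.elementaryCount ≤ 2 * (P.length * (11 * (W + 1) ^ 3)) + 22 * R + 4 ∧
      A.oracleCount = 1 ∧
      ∀ (d : (Fin n → Bool) → (Fin m → Bool)) (U : OracleUnitary n m), IsDigitalEncoding d U →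
        A.run U (digitalState k d) = ((1 / √((2 : ℝ) ^ n) : ℝ) : ℂ) • ∑ j : Fin n → Bool,
          ((fracVal fun i : Fin R => g (Fin.append (d j) (zeros (Fin t))) (Fin.castLE hR i) : ℝ)
            : ℂ) • ket (join j (zeros (Fin m)) (zeros (Fin k))) := by
  let k := Fintype.card (Ancilla t r s W R)
  let F : Fin m ⊕ Ancilla t r s W R → Wire n m k :=
    Sum.elim (fun i => Sum.inr (Sum.inl i)) (fun a => Sum.inr (Sum.inr (Fintype.equivFin (Ancilla t r s W R) a)))
  have hF : Function.Injective F := by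
    rintro (i | a) (j | b) h <;> simp only [F, Sum.elim_inl, Sum.elim_inr] at h <;> simp at h <;> simp [h]
  -- The first `m` input qubits of the arithmetic are the data register itself; the padding, result
  -- and work qubits are ancillas.
  let E₀ : (Fin m ⊕ Fin t) ⊕ (Fin r ⊕ Fin s) → Fin m ⊕ Ancilla t r s W R :=
    Sum.elim (Sum.elim Sum.inl fun i => Sum.inr (Sum.inl (Sum.inl i)))
      fun p => Sum.inr (Sum.inl (Sum.inr p))
  have hE₀ : Function.Injective E₀ := by
    rintro ((i | i) | i) ((j | j) | j) h <;>
      simp only [E₀, Sum.elim_inl, Sum.elim_inr] at h <;> simp at h <;> simp [h]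
  let e : Wire (m + t) r s → Wire n m k :=
    fun p => F (E₀ (Sum.map finSumFinEquiv.symm id p))
  have he : Function.Injective e := hF.comp (hE₀.comp
    (Sum.map_injective.2 ⟨finSumFinEquiv.symm.injective, Function.injective_id⟩))
  let w : Fin W ⊕ (Fin R ⊕ (Fin R ⊕ Fin 3)) → Wire n m k := fun b => F (Sum.inr (Sum.inr b))
  have hw : Function.Injective w := fun a b h =>
    Sum.inr_injective (Sum.inr_injective (hF h))
  have hew : ∀ p b, e p ≠ w b := by
    intro p b h
    have h' : E₀ (Sum.map finSumFinEquiv.symm id p) = Sum.inr (Sum.inr b) := hF h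
    generalize Sum.map finSumFinEquiv.symm id p = p' at h'
    rcases p' with (i | i) | i <;> simp [E₀] at h'
  -- The value for `i ≥ W` is a dummy: no step is wider than `W`.
  let h : ℕ → Wire n m k := fun i =>
    if hi : i < W then w (Sum.inl ⟨i, hi⟩) else w (Sum.inr (Sum.inr (Sum.inr 0)))
  have hh : ∀ i (hi : i < W), h i = w (Sum.inl ⟨i, hi⟩) := fun i hi => dif_pos hi
  let T : Wire n m k := w (Sum.inr (Sum.inr (Sum.inr 0)))
  let q : Wire n m k := w (Sum.inr (Sum.inr (Sum.inr 1)))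
  let S : Wire n m k := w (Sum.inr (Sum.inr (Sum.inr 2)))
  let c : Fin R → Wire n m k := fun i => e (Sum.inr (Sum.inl (Fin.castLE hR i)))
  let y : Fin R → Wire n m k := fun i => w (Sum.inr (Sum.inl i))
  let t' : Fin R → Wire n m k := fun i => w (Sum.inr (Sum.inr (Sum.inl i)))
  let G := compile e he h T P
  have hGlen : G.length ≤ P.length * (11 * (W + 1) ^ 3) := length_compile_le e he h T P W hW
  -- The NOT gates set the control `q` of the conversion and clear it afterwards. The oracle call
  -- comes last, when the digits have been erased and the data register still holds `d_j`.
  let A : Algorithm n m k := gates G ++ (.gate (.one q notU) :: (dac R q S c y t' ++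
    (.gate (.one q notU) :: (gates (inverse G) ++ [.oracleInv]))))
  refine ⟨k, A, ?_, ?_, fun d U hU => ?_⟩
  · have h1 : A.elementaryCount ≤ A.length := List.countP_le_length
    have h2 := length_dac_le R q S c y t'
    have h3 : A.length = G.length + ((dac R q S c y t').length + (G.length + 1) + 1 + 1) := by
      simp only [A, gates, List.length_append, List.length_cons, List.length_map, length_inverse,
        List.length_nil]
      omega
    omega
  · simp only [Algorithm.oracleCount, A, List.countP_append, List.countP_cons, List.countP_nil,
      countP_isOracle_gates, countP_isOracle_dac]
    rfl
  have key : ∀ j, runLin U A (ket (join j (d j) (zeros (Fin k)))) =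
      ((fracVal fun i : Fin R => g (Fin.append (d j) (zeros (Fin t))) (Fin.castLE hR i) : ℝ) : ℂ) •
        ket (join j (zeros (Fin m)) (zeros (Fin k))) := by
    intro j
    set a := Fin.append (d j) (zeros (Fin t)) with ha
    set bg : Wire n m k → Bool := join j (zeros (Fin m)) (zeros (Fin k)) with hbg
    have hbgw : ∀ b, bg (w b) = false := fun b => rfl
    -- The background has an empty data register, but `e` covers that register, so the padded input
    -- `a` fills it with `d j`.
    have hstart : Function.extend e (join a (zeros (Fin r)) (zeros (Fin s))) bg =
        join j (d j) (zeros (Fin k)) := by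
      have hm : ∀ i, e (Sum.inl (Fin.castAdd t i)) = Sum.inr (Sum.inl i) := by
        intro i
        simp [e, E₀, F]
      funext p
      by_cases hp : ∃ p', e p' = p
      · obtain ⟨p', rfl⟩ := hp
        rw [he.extend_apply]
        rcases p' with i | i | i
        · refine Fin.addCases (fun i => ?_) (fun i => ?_) i
          · rw [hm]
            simp [join, ha]
          · simp [join, ha, e, E₀, F, zeros]
        · rfl
        · rfl
      · rw [Function.extend_apply' _ _ _ hp]
        rcases p with i | i | i
        · rfl
        · exact absurd ⟨_, hm i⟩ hp
        · rfl
    set z := Function.extend e (join a (g a) (zeros (Fin s))) bg with hz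
    have hzw : ∀ b, z (w b) = false := fun b => by
      rw [hz, Function.extend_apply' _ _ _ fun ⟨p, hp⟩ => hew p b hp, hbgw]
    have hG : circuit G (ket (join j (d j) (zeros (Fin k)))) = ket z := by
      rw [← hstart, ← embed_ket he, circuit_compile e he h T W _ _ _ _ bg _ _ P hW, hP,
        embed_ket he]
      · intro i hi i' hi' hii
        rw [hh i hi, hh i' hi'] at hii
        simpa using hw hii
      · intro i hi hii
        rw [hh i hi] at hii
        simpa using hw hii
      · intro p i hi
        rw [hh i hi]
        exact hew _ _
      · exact fun p hp => hew p _ hp.symm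
      · intro i hi
        rw [hh i hi, hbgw]
      · exact hbgw _
    have hG' : circuit (inverse G) (ket z) = ket (join j (d j) (zeros (Fin k))) := by
      rw [← hG, circuit_inverse]
    set z' := Function.update z q true with hz'
    have hz'w : ∀ b, w b ≠ q → z' (w b) = false := fun b hb => by
      rw [hz', Function.update_of_ne hb, hzw]
    have hqz : Function.update z' q (!z' q) = z := by
      rw [hz', Function.update_self, Function.update_idem]
      exact Function.update_eq_self_iff.2 (hzw _).symm
    have hdac := runLin_dac U R q S c y t' (hw.ne (by simp)) (fun i => (hew _ _).symm)
      (fun i => hw.ne (by simp)) (fun i => hw.ne (by simp)) (fun i => (hew _ _).symm)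
      (fun i => hw.ne (by simp)) (fun i => hw.ne (by simp)) (fun i j => hew _ _)
      (fun i j => hew _ _) (fun i j => hw.ne (by simp))
      (fun i j hij => by simpa using hw hij) (fun i j hij => by simpa using hw hij)
      z' (hz'w _ (hw.ne (by simp))) (fun i => hz'w _ (hw.ne (by simp)))
      (fun i => hz'w _ (hw.ne (by simp)))
    have hc : ∀ i, z' (c i) = g a (Fin.castLE hR i) := fun i => by
      rw [hz', Function.update_of_ne (hew _ _), hz]
      exact he.extend_apply _ _ _
    have hq : z' q = true := Function.update_self _ _ _
    rw [if_pos hq] at hdac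
    simp only [hc] at hdac
    have hX : (Gate.one q notU).apply (ket z) = ket z' := by
      rw [not_ket, hzw]
      rfl
    have hX' : (Instr.gate (Gate.one q notU)).toLin U (ket z') = ket z := by
      change (Gate.one q notU).apply (ket z') = ket z
      rw [not_ket, hqz]
    rw [runLin_append, runLin_gates, hG, runLin_cons]
    change runLin U _ ((Gate.one q notU).apply (ket z)) = _
    rw [hX, runLin_append, hdac, map_smul, runLin_cons]
    change _ • runLin U _ ((Instr.gate (Gate.one q notU)).toLin U (ket z')) = _
    rw [hX', runLin_append, runLin_gates, hG', runLin_cons, oracleInv_ket hU, runLin_nil]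
  rw [run_eq_runLin, digitalState, map_smul, map_sum]
  simp only [key]

/-! ### Success probability and normalized output -/

theorem normSq_sum_smul_ket {ι β : Type} [DecidableEq ι] [Fintype ι] [Fintype β]
    {J : β → ι → Bool} (hJ : Function.Injective J) (v : β → ℂ) :
    normSq (∑ j, v j • ket (J j)) = ∑ j, ‖v j‖ ^ 2 := by
  classical
  refine (Fintype.sum_of_injective J hJ _ _ (fun x hx => ?_) fun i => ?_).symm
  · have : ∀ j, x ≠ J j := fun j h => hx ⟨j, h.symm⟩
    simp [Finset.sum_apply, ket, this]
  · simp [Finset.sum_apply, ket, Pi.single_apply, hJ.eq_iff]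

/-- Success probability and output of an algorithm with a given final state. -/
theorem successProb_and_output {A : Algorithm n m k} {U : OracleUnitary n m}
    {ψ : State (Wire n m k)} {v : (Fin n → Bool) → ℝ}
    (hA : A.run U ψ = ((1 / √((2 : ℝ) ^ n) : ℝ) : ℂ) • ∑ j : Fin n → Bool,
      ((v j : ℝ) : ℂ) • ket (join j (zeros (Fin m)) (zeros (Fin k)))) :
    A.successProb U ψ = (∑ j, v j ^ 2) / 2 ^ n ∧
      (0 < A.successProb U ψ → ∃ C : ℝ, 0 < C ∧
        A.output U ψ = (C : ℂ) • ∑ j : Fin n → Bool, ((v j : ℝ) : ℂ) •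
          ket (join j (zeros (Fin m)) (zeros (Fin k))) ∧
        A.successProb U ψ = 1 / (2 ^ n * C ^ 2)) := by
  have hJ : Function.Injective fun j : Fin n → Bool =>
      (join j (zeros (Fin m)) (zeros (Fin k)) : Wire n m k → Bool) := fun i j h =>
    funext fun q => congrFun h (Sum.inl q)
  have hN : (√((2 : ℝ) ^ n)) ^ 2 = 2 ^ n := Real.sq_sqrt (by positivity)
  -- The constant combines the normalization `1 / √P` of the successful branch with the factor `1 /
  -- √N` of the input.
  refine ⟨?_, fun hpos => ⟨1 / √(A.successProb U ψ) * (1 / √((2 : ℝ) ^ n)), by positivity, ?_, ?_⟩⟩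
  · rw [Algorithm.successProb, hA, Finset.smul_sum]
    simp only [smul_smul]
    rw [normSq_sum_smul_ket hJ, Finset.sum_div]
    refine Finset.sum_congr rfl fun j _ => ?_
    rw [← Complex.ofReal_mul, Complex.norm_real, Real.norm_eq_abs, sq_abs, mul_pow, div_pow, hN]
    ring
  · rw [Algorithm.output, normalize, hA, smul_smul, ← Complex.ofReal_mul, ← hA]
    rfl
  · rw [mul_pow, div_pow, div_pow, hN, Real.sq_sqrt hpos.le]
    field_simp

/-- Natural coefficients make the polynomial monotone on nonnegative reals, so a bound at an integer
precision passes to a bound in `log₂ (1 / ε)`. -/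
theorem eval_natCast_le {Q : ℕ[X]} {M : ℕ} {x : ℝ} (h : (M : ℝ) ≤ x) :
    ((Q.eval M : ℕ) : ℝ) ≤ (Q.map (Nat.castRingHom ℝ)).eval x := by
  have hM := Polynomial.eval_natCast_map (Nat.castRingHom ℝ) Q M
  rw [Nat.cast_id, eq_natCast] at hM
  rw [← hM, Polynomial.eval_eq_sum_range, Polynomial.eval_eq_sum_range]
  refine Finset.sum_le_sum fun i _ => ?_
  rw [Polynomial.coeff_map]
  have : 0 ≤ (Nat.castRingHom ℝ) (Q.coeff i) := Nat.cast_nonneg _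
  gcongr

end QDAC

end

/-! ### Choice of the precision and the gate count -/

theorem corollary1p1 (f : ℝ → ℝ)
    (hf : ∀ x ∈ Set.Ico (0 : ℝ) 1, f x ∈ Set.Ico (0 : ℝ) 1)
    (hcomp : QDAC.ArithComputable f) :
    ∃ p : ℝ[X], ∀ (m : ℕ) (ε : ℝ), 0 < ε → ε ≤ (1 / 2 : ℝ) ^ m →
      ∃ ft : (Fin m → Bool) → ℝ,
        (∀ b : Fin m → Bool, |ft b - f (QDAC.fracVal b)| ≤ ε) ∧
        ∀ n : ℕ, ∃ (k : ℕ) (A : QDAC.Algorithm n m k),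
          (A.elementaryCount : ℝ) ≤ p.eval (Real.logb 2 (1 / ε)) ∧
          A.oracleCount = 1 ∧
          ∀ (d : (Fin n → Bool) → (Fin m → Bool)) (U : QDAC.OracleUnitary n m),
            QDAC.IsDigitalEncoding d U →
              A.successProb U (QDAC.digitalState k d) = (∑ j, ft (d j) ^ 2) / 2 ^ n ∧
              (0 < A.successProb U (QDAC.digitalState k d) →
                ∃ C : ℝ, 0 < C ∧
                  A.output U (QDAC.digitalState k d) =
                    (C : ℂ) • ∑ j : Fin n → Bool, ((ft (d j) : ℝ) : ℂ) •
                      QDAC.ket (QDAC.join j (QDAC.zeros (Fin m)) (QDAC.zeros (Fin k))) ∧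
                  A.successProb U (QDAC.digitalState k d) = 1 / (2 ^ n * C ^ 2)) := by
  obtain ⟨p, hp⟩ := hcomp
  -- The count of `exists_algorithm` at working precision `X`, with `p` bounding both the number of
  -- steps and their width, and at most `X` digits converted. The shift by 2 below covers the
  -- ceiling and the extra bit in the precision `⌈L⌉₊ + 1`.
  let Q : ℕ[X] := 2 * (p * (11 * (p + 1) ^ 3)) + 22 * Polynomial.X + 4
  refine ⟨(Q.map (Nat.castRingHom ℝ)).comp (Polynomial.X + 2), fun m ε hε hεm => ?_⟩
  set L := Real.logb 2 (1 / ε) with hL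
  have h2L : (2 : ℝ) ^ L = 1 / ε := Real.rpow_logb (by norm_num) (by norm_num) (by positivity)
  have hmL : (m : ℝ) ≤ L := by
    rw [hL, Real.le_logb_iff_rpow_le (by norm_num) (by positivity), Real.rpow_natCast,
      le_div_iff₀ hε]
    calc (2 : ℝ) ^ m * ε ≤ 2 ^ m * (1 / 2) ^ m := by gcongr
      _ = 1 := by rw [← mul_pow]; norm_num
  have hL0 : 0 ≤ L := (Nat.cast_nonneg m).trans hmL
  have hceil : (1 / 2 : ℝ) ^ ⌈L⌉₊ ≤ ε := by
    have h1 : 1 / ε ≤ (2 : ℝ) ^ ⌈L⌉₊ := by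
      rw [← h2L, ← Real.rpow_natCast]
      exact Real.rpow_le_rpow_of_exponent_le (by norm_num) (Nat.le_ceil L)
    rw [div_pow, one_pow, div_le_iff₀ (by positivity)]
    rwa [div_le_iff₀ hε, mul_comm] at h1
  -- Inputs are padded by `t` zeros, which leaves their value unchanged, to reach the working
  -- precision. The extra bit makes room for two errors of size `2 ^ (-(m + t))`: one from the
  -- arithmetic, one from cutting the result.
  obtain ⟨t, ht⟩ : ∃ t, ⌈L⌉₊ + 1 = m + t := Nat.exists_eq_add_of_le
    (by have : (m : ℝ) ≤ ⌈L⌉₊ := hmL.trans (Nat.le_ceil L)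
        exact (Nat.cast_le.1 this).trans (Nat.le_succ _))
  have hM : ((m + t : ℕ) : ℝ) ≤ L + 2 := by
    rw [← ht]
    push_cast
    linarith [Nat.ceil_lt_add_one hL0]
  have hacc : (1 / 2 : ℝ) ^ (m + t) + (1 / 2) ^ (m + t) ≤ ε := by
    rw [← ht, pow_succ]
    linarith
  obtain ⟨r, s, P, g, hlen, hwidth, hrun, happrox⟩ := hp (m + t)
  -- The result is cut to `m + t` digits because `r` may be too large for the gate count; the
  -- minimum handles a shorter result. Nothing here depends on `n`.
  refine ⟨fun b => QDAC.fracVal fun i : Fin (min r (m + t)) =>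
    g (Fin.append b (QDAC.zeros (Fin t))) (Fin.castLE (min_le_left _ _) i), fun b => ?_,
    fun n => ?_⟩
  · have h1 := QDAC.abs_fracVal_castLE_sub_le (min_le_left r (m + t)) (min_choice r (m + t))
      (g (Fin.append b (QDAC.zeros (Fin t))))
    have h2 := happrox (Fin.append b (QDAC.zeros (Fin t)))
    rw [QDAC.fracVal_append_zeros] at h2
    exact (abs_sub_le _ _ _).trans ((add_le_add h1 h2).trans hacc)
  · obtain ⟨k, A, hcount, horacle, hA⟩ := QDAC.exists_algorithm (min_le_left r (m + t)) P hwidth g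
      hrun n
    refine ⟨k, A, ?_, horacle, fun d U hU => QDAC.successProb_and_output (hA d U hU)⟩
    have h1 : A.elementaryCount ≤ Q.eval (m + t) := by
      refine hcount.trans ?_
      simp only [Q, Polynomial.eval_add, Polynomial.eval_mul, Polynomial.eval_pow,
        Polynomial.eval_X, Polynomial.eval_ofNat, Polynomial.eval_one]
      gcongr
      exact min_le_right _ _
    rw [Polynomial.eval_comp, Polynomial.eval_add, Polynomial.eval_X, Polynomial.eval_ofNat]
    exact (Nat.cast_le.2 h1).trans (QDAC.eval_natCast_le hM)
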